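/- We work in the applied pi calculus. A signature is a finite set of function symbols with arities, equipped with an equational theory. Terms are built from names, variables and function symbols. Plain processes are $$P,Q ::= 0 \mid \overline{M}\langle N\rangle.P \mid M(x).P \mid \nu n.P \mid \mathrm{if}\ M=N\ \mathrm{then}\ P\ \mathrm{else}\ Q \mid P+Q \mid P|Q \mid\ !P,$$ and extended processes are obtained from plain processes and active substitutions $\{M/x\}$ by restriction $\nu n$, $\nu x$ and parallel composition (substitutions are cycle-free, parallel components have disjoint domains, and only variables in the domain are restricted). $A$ is closed if $\mathrm{fv}(A)=\mathrm{dom}(A)$. Let $\equiv$ be structural equivalence, $\longrightarrow$ internal reduction, and $\overset{\alpha}{\longrightarrow}$ the labelled transitions, with inputs $\alpha=M(N)$ and outputs $\alpha=\nu x.\overline{M}\langle x\rangle$, all taken modulo the equational theory. Write $\Longrightarrow$ for the reflexive transitive closure of $\longrightarrow$; for an action $\mu$, $\overset{\mu}{\Longrightarrow}$ is $\Longrightarrow$ if $\mu$ is silent and $\Longrightarrow\overset{\mu}{\longrightarrow}\Longrightarrow$ otherwise. The frame of $A$ is obtained by replacing its plain subprocesses by $0$. For a frame $\varphi$, $(M=N)\varphi$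 means that the variables of $M,N$ lie in $\mathrm{dom}(\varphi)$ and that, for some names $\widetilde n$ not occurring in $M,N$ and some active substitution $\sigma$, $\varphi\equiv\nu\widetilde n.\sigma$ and $M\sigma=N\sigma$ holds in the equational theory. Closed processes $A,B$ are statically equivalent, $A\approx_s B$, if their frames have the same domain and satisfy the same equations $(M=N)$. A trace of $A$ is a finite sequence $A=A_0\overset{\mu_1}{\Longrightarrow}A_1\cdots\overset{\mu_n}{\Longrightarrow}A_n$ with every $A_i$ closed and $\mathrm{fv}(\mu_i)\subseteq\mathrm{dom}(A_{i-1})$. It is safe if all transitions are derived without $\alpha$-conversion and no $\mu_i$ contains a bound name or a restricted variable of $A$. Two traces are statically equivalent if they have the same length and the same actions and their $i$-th processes are statically equivalent for all $i\ge 0$. Trace matching problem. Input: closed extended processes $A,B$ and a safe trace $\mathbf{tr}$ of $B$. Question: does $A$ have a safe trace that is statically equivalent to $\mathbf{tr}$? **Proposition.** There is a finite signature, with an equational theory generated by finitely many equations between name-free terms, for which the trace matching problem is undecidable, even if the input processes $A,B$ are restricted to closed plain processes. That is, no algorithm halts with the correct yes/no answer on all such inputs $(A,B,\mathbf{tr})$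 (nothing is required of it on data that are not valid inputs). -/

import Mathlib

namespace AppliedPi

/-- A signature: finitely many function symbols, each with an arity. -/
structure Signature where
  numSymbols : ℕ
  arity : Fin numSymbols → ℕ

/-- Terms over a signature. Names and variables are two disjoint countably infinite sorts,
each indexed by `ℕ`. -/
inductive Term (S : Signature) : Type
  | name (n : ℕ) : Term S
  | var (x : ℕ) : Term S
  | app (f : Fin S.numSymbols) (args : Fin (S.arity f) → Term S) : Term S

/-- An identifier (the `u` in `ν u. A`): a name or a variable. -/
inductive Ident : Type
  | name (n : ℕ) : Ident
  | var (x : ℕ) : Ident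

variable {S : Signature}

namespace Term

/-- The set of names of a term. -/
def names : Term S → Finset ℕ
  | name n => {n}
  | var _ => ∅
  | app _ args => Finset.univ.biUnion fun i => (args i).names

/-- The set of variables of a term. -/
def vars : Term S → Finset ℕ
  | name _ => ∅
  | var x => {x}
  | app _ args => Finset.univ.biUnion fun i => (args i).vars

/-- Simultaneous substitution of terms for variables. -/
def subst (σ : ℕ → Term S) : Term S → Term S
  | name n => name n
  | var x => σ x
  | app f args => app f fun i => (args i).subst σ

/-- Renaming of names by `f` and of variables by `g`. -/
def rename (f g : ℕ → ℕ) : Term S → Term S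
  | name n => name (f n)
  | var x => var (g x)
  | app h args => app h fun i => (args i).rename f g

/-- Numerical code of a term. -/
def code : Term S → ℕ
  | name n => Nat.pair 0 n
  | var x => Nat.pair 1 x
  | app f args => Nat.pair 2 (Nat.pair f (Encodable.encode (List.ofFn fun i => (args i).code)))

end Term

/-- The substitution `{M/x}` on terms. -/
def single (x : ℕ) (M : Term S) : ℕ → Term S := fun y => if y = x then M else Term.var y

/-- The equational theory generated by a list of equations: the least congruence on terms
which contains all substitution instances of the equations. -/
inductive EqTheory (ax : List (Term S × Term S)) : Term S → Term S → Prop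
  | ax (e : Term S × Term S) (he : e ∈ ax) (σ : ℕ → Term S) :
      EqTheory ax (e.1.subst σ) (e.2.subst σ)
  | refl (M : Term S) : EqTheory ax M M
  | symm {M N : Term S} : EqTheory ax M N → EqTheory ax N M
  | trans {M N K : Term S} : EqTheory ax M N → EqTheory ax N K → EqTheory ax M K
  | congr (f : Fin S.numSymbols) {a b : Fin (S.arity f) → Term S} :
      (∀ i, EqTheory ax (a i) (b i)) → EqTheory ax (Term.app f a) (Term.app f b)

/-- Raw processes. Plain and extended processes are carved out by `Proc.Plain` and `Proc.WF`. -/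
inductive Proc (S : Signature) : Type
  | nil : Proc S
  /-- `out M N P` is the output `M⟨N⟩.P` -/
  | out (M N : Term S) (P : Proc S) : Proc S
  /-- `inp M x P` is the input `M(x).P` -/
  | inp (M : Term S) (x : ℕ) (P : Proc S) : Proc S
  /-- `ite M N P Q` is `if M = N then P else Q` -/
  | ite (M N : Term S) (P Q : Proc S) : Proc S
  | choice (P Q : Proc S) : Proc S
  | par (A B : Proc S) : Proc S
  | repl (P : Proc S) : Proc S
  /-- `res u A` is the restriction `ν u. A` of a name or of a variable -/
  | res (u : Ident) (A : Proc S) : Proc S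
  /-- `act x M` is the active substitution `{M/x}` -/
  | act (x : ℕ) (M : Term S) : Proc S

namespace Proc

/-- Plain processes. -/
def Plain : Proc S → Prop
  | nil => True
  | out _ _ P => P.Plain
  | inp _ _ P => P.Plain
  | ite _ _ P Q => P.Plain ∧ Q.Plain
  | choice P Q => P.Plain ∧ Q.Plain
  | par A B => A.Plain ∧ B.Plain
  | repl P => P.Plain
  | res (.name _) A => A.Plain
  | res (.var _) _ => False
  | act _ _ => False

/-- Free names. -/
def fn : Proc S → Finset ℕ
  | nil => ∅
  | out M N P => M.names ∪ N.names ∪ P.fn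
  | inp M _ P => M.names ∪ P.fn
  | ite M N P Q => M.names ∪ N.names ∪ P.fn ∪ Q.fn
  | choice P Q => P.fn ∪ Q.fn
  | par A B => A.fn ∪ B.fn
  | repl P => P.fn
  | res (.name n) A => A.fn \ {n}
  | res (.var _) A => A.fn
  | act _ M => M.names

/-- Free variables. -/
def fv : Proc S → Finset ℕ
  | nil => ∅
  | out M N P => M.vars ∪ N.vars ∪ P.fv
  | inp M x P => M.vars ∪ (P.fv \ {x})
  | ite M N P Q => M.vars ∪ N.vars ∪ P.fv ∪ Q.fv
  | choice P Q => P.fv ∪ Q.fv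
  | par A B => A.fv ∪ B.fv
  | repl P => P.fv
  | res (.name _) A => A.fv
  | res (.var x) A => A.fv \ {x}
  | act x M => M.vars ∪ {x}

/-- Bound names. -/
def bn : Proc S → Finset ℕ
  | nil => ∅
  | out _ _ P => P.bn
  | inp _ _ P => P.bn
  | ite _ _ P Q => P.bn ∪ Q.bn
  | choice P Q => P.bn ∪ Q.bn
  | par A B => A.bn ∪ B.bn
  | repl P => P.bn
  | res (.name n) A => A.bn ∪ {n}
  | res (.var _) A => A.bn
  | act _ _ => ∅

/-- Restricted variables. -/
def rv : Proc S → Finset ℕ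
  | par A B => A.rv ∪ B.rv
  | res (.name _) A => A.rv
  | res (.var x) A => A.rv ∪ {x}
  | _ => ∅

/-- The domain of an extended process. -/
def dom : Proc S → Finset ℕ
  | par A B => A.dom ∪ B.dom
  | res (.name _) A => A.dom
  | res (.var x) A => A.dom \ {x}
  | act x _ => {x}
  | _ => ∅

/-- `A.Dep x y`: following the active substitutions of `A` at least once, starting from the free
variable `x`, one can arrive at a term that contains the free variable `y` (the paths may go
through restricted variables). The active substitutions are cycle-free iff this relation is
irreflexive. -/
def Dep : Proc S → ℕ → ℕ → Prop
  | par A B => Relation.TransGen fun x y => A.Dep x y ∨ B.Dep x y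
  | res (.name _) A => A.Dep
  | res (.var z) A => fun x y => A.Dep x y ∧ x ≠ z ∧ y ≠ z
  | act z M => fun x y => x = z ∧ y ∈ M.vars
  | _ => fun _ _ => False

/-- Extended processes: only plain processes below prefixes, conditionals, choices and
replications; active substitutions are cycle-free; parallel components have disjoint domains;
only variables in the domain are restricted. -/
def WF : Proc S → Prop
  | nil => True
  | out _ _ P => P.Plain
  | inp _ _ P => P.Plain
  | ite _ _ P Q => P.Plain ∧ Q.Plain
  | choice P Q => P.Plain ∧ Q.Plain
  | par A B => A.WF ∧ B.WF ∧ Disjoint A.dom B.dom ∧ ∀ x, ¬ (par A B).Dep x x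
  | repl P => P.Plain
  | res (.name _) A => A.WF
  | res (.var x) A => A.WF ∧ x ∈ A.dom
  | act x M => x ∉ M.vars

/-- Closed processes. -/
def Closed (A : Proc S) : Prop := A.fv = A.dom

/-- `A.subst x M` replaces the free occurrences of `x` in `A` by `M`, without any renaming.
It is always used together with `NoCapture`. (`x` is never in the domain of `A` there.) -/
def subst (x : ℕ) (M : Term S) : Proc S → Proc S
  | nil => nil
  | out K N P => out (K.subst (single x M)) (N.subst (single x M)) (P.subst x M)
  | inp K y P => inp (K.subst (single x M)) y (if y = x then P else P.subst x M)
  | ite K N P Q =>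
      ite (K.subst (single x M)) (N.subst (single x M)) (P.subst x M) (Q.subst x M)
  | choice P Q => choice (P.subst x M) (Q.subst x M)
  | par A B => par (A.subst x M) (B.subst x M)
  | repl P => repl (P.subst x M)
  | res (.name n) A => res (.name n) (A.subst x M)
  | res (.var y) A => res (.var y) (if y = x then A else A.subst x M)
  | act y N => act y (N.subst (single x M))

/-- No free occurrence of `x` in `A` lies in the scope of a binder for a name or variable of `M`,
so that `A.subst x M` is the capture-avoiding substitution `A{M/x}`. -/
def NoCapture (x : ℕ) (M : Term S) : Proc S → Prop
  | nil => True
  | out _ _ P => P.NoCapture x M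
  | inp _ y P => y = x ∨ (P.NoCapture x M ∧ (x ∈ P.fv → y ∉ M.vars))
  | ite _ _ P Q => P.NoCapture x M ∧ Q.NoCapture x M
  | choice P Q => P.NoCapture x M ∧ Q.NoCapture x M
  | par A B => A.NoCapture x M ∧ B.NoCapture x M
  | repl P => P.NoCapture x M
  | res (.name n) A => A.NoCapture x M ∧ (x ∈ A.fv → n ∉ M.names)
  | res (.var y) A => y = x ∨ (A.NoCapture x M ∧ (x ∈ A.fv → y ∉ M.vars))
  | act _ _ => True

/-- Renaming of all (free, bound and binding) names by `f` and variables by `g`. -/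
def rename (f g : ℕ → ℕ) : Proc S → Proc S
  | nil => nil
  | out M N P => out (M.rename f g) (N.rename f g) (P.rename f g)
  | inp M x P => inp (M.rename f g) (g x) (P.rename f g)
  | ite M N P Q => ite (M.rename f g) (N.rename f g) (P.rename f g) (Q.rename f g)
  | choice P Q => choice (P.rename f g) (Q.rename f g)
  | par A B => par (A.rename f g) (B.rename f g)
  | repl P => repl (P.rename f g)
  | res (.name n) A => res (.name (f n)) (A.rename f g)
  | res (.var x) A => res (.var (g x)) (A.rename f g)
  | act x M => act (g x) (M.rename f g)

/-- `u` occurs free in the process. -/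
def IsFree (A : Proc S) : Ident → Prop
  | .name n => n ∈ A.fn
  | .var x => x ∈ A.fv

/-- Numerical code of a process. -/
def code : Proc S → ℕ
  | nil => Nat.pair 0 0
  | out M N P => Nat.pair 1 (Nat.pair M.code (Nat.pair N.code P.code))
  | inp M x P => Nat.pair 2 (Nat.pair M.code (Nat.pair x P.code))
  | ite M N P Q => Nat.pair 3 (Nat.pair M.code (Nat.pair N.code (Nat.pair P.code Q.code)))
  | choice P Q => Nat.pair 4 (Nat.pair P.code Q.code)
  | par A B => Nat.pair 5 (Nat.pair A.code B.code)
  | repl P => Nat.pair 6 P.code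
  | res (.name n) A => Nat.pair 7 (Nat.pair n A.code)
  | res (.var x) A => Nat.pair 8 (Nat.pair x A.code)
  | act x M => Nat.pair 9 (Nat.pair x M.code)

end Proc

open Proc

/-- α-equivalence: the least congruence which allows to replace a binding name or variable by one
that is not free in its scope. (Swapping the two is then a capture-avoiding renaming.) -/
inductive AlphaEq : Proc S → Proc S → Prop
  | refl (A : Proc S) : AlphaEq A A
  | symm {A B : Proc S} : AlphaEq A B → AlphaEq B A
  | trans {A B C : Proc S} : AlphaEq A B → AlphaEq B C → AlphaEq A C
  | resName (n m : ℕ) (A : Proc S) : m ∉ A.fn →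
      AlphaEq (res (.name n) A) (res (.name m) (A.rename (Equiv.swap n m) id))
  | resVar (x y : ℕ) (A : Proc S) : y ∉ A.fv →
      AlphaEq (res (.var x) A) (res (.var y) (A.rename id (Equiv.swap x y)))
  | inpVar (M : Term S) (x y : ℕ) (P : Proc S) : y ∉ P.fv →
      AlphaEq (inp M x P) (inp M y (P.rename id (Equiv.swap x y)))
  | out (M N : Term S) {P P' : Proc S} : AlphaEq P P' → AlphaEq (out M N P) (out M N P')
  | inp (M : Term S) (x : ℕ) {P P' : Proc S} : AlphaEq P P' → AlphaEq (inp M x P) (inp M x P')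
  | ite (M N : Term S) {P P' Q Q' : Proc S} : AlphaEq P P' → AlphaEq Q Q' →
      AlphaEq (ite M N P Q) (ite M N P' Q')
  | choice {P P' Q Q' : Proc S} : AlphaEq P P' → AlphaEq Q Q' →
      AlphaEq (choice P Q) (choice P' Q')
  | par {A A' B B' : Proc S} : AlphaEq A A' → AlphaEq B B' → AlphaEq (par A B) (par A' B')
  | repl {P P' : Proc S} : AlphaEq P P' → AlphaEq (repl P) (repl P')
  | res (u : Ident) {A A' : Proc S} : AlphaEq A A' → AlphaEq (res u A) (res u A')

/-- Structural equivalence of extended processes modulo the equational theory `E`: the least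
equivalence relation closed under evaluation contexts that contains the listed laws and, if
`conv` holds, α-conversion. All processes involved are extended processes (`WF`).
`conv = True` is structural equivalence, `conv = False` is structural equivalence derived without
α-conversion. -/
inductive StructEq (E : Term S → Term S → Prop) (conv : Prop) : Proc S → Proc S → Prop
  | refl {A : Proc S} : A.WF → StructEq E conv A A
  | symm {A B : Proc S} : StructEq E conv A B → StructEq E conv B A
  | trans {A B C : Proc S} : StructEq E conv A B → StructEq E conv B C → StructEq E conv A C
  | alpha {A B : Proc S} : conv → AlphaEq A B → A.WF → B.WF → StructEq E conv A B
  -- evaluation contexts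
  | ctxPar {A A' B : Proc S} : StructEq E conv A A' → (par A B).WF → (par A' B).WF →
      StructEq E conv (par A B) (par A' B)
  | ctxRes (u : Ident) {A A' : Proc S} : StructEq E conv A A' → (res u A).WF → (res u A').WF →
      StructEq E conv (res u A) (res u A')
  | ctxChoice {P P' Q : Proc S} : StructEq E conv P P' → (choice P Q).WF → (choice P' Q).WF →
      StructEq E conv (choice P Q) (choice P' Q)
  -- laws
  | parNil {A : Proc S} : A.WF → (par A nil).WF → StructEq E conv (par A nil) A
  | parAssoc {A B C : Proc S} : (par (par A B) C).WF → (par A (par B C)).WF →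
      StructEq E conv (par (par A B) C) (par A (par B C))
  | parComm {A B : Proc S} : (par A B).WF → (par B A).WF →
      StructEq E conv (par A B) (par B A)
  | scope {u : Ident} {A B : Proc S} : ¬ B.IsFree u →
      (par (res u A) B).WF → (res u (par A B)).WF →
      StructEq E conv (par (res u A) B) (res u (par A B))
  | resComm {u v : Ident} {A : Proc S} : (res u (res v A)).WF → (res v (res u A)).WF →
      StructEq E conv (res u (res v A)) (res v (res u A))
  | repl {P : Proc S} : (repl P).WF → (par P (repl P)).WF →
      StructEq E conv (repl P) (par P (repl P))
  | choiceComm {P Q : Proc S} : (choice P Q).WF → (choice Q P).WF →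
      StructEq E conv (choice P Q) (choice Q P)
  | hide {x : ℕ} {M : Term S} : (res (.var x) (act x M)).WF →
      StructEq E conv (res (.var x) (act x M)) nil
  | subst {A : Proc S} {x : ℕ} {M : Term S} : A.NoCapture x M →
      (par A (act x M)).WF → (par (A.subst x M) (act x M)).WF →
      StructEq E conv (par A (act x M)) (par (A.subst x M) (act x M))
  | rewrite {x : ℕ} {M N : Term S} : E M N → (act x M).WF → (act x N).WF →
      StructEq E conv (act x M) (act x N)

/-- Internal reduction (`conv = False`: derived without α-conversion). -/
inductive Red (E : Term S → Term S → Prop) (conv : Prop) : Proc S → Proc S → Prop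
  | ifTrue {M N : Term S} {P Q : Proc S} : E M N → (ite M N P Q).WF →
      Red E conv (ite M N P Q) P
  | ifFalse {M N : Term S} {P Q : Proc S} : ¬ E M N → M.vars = ∅ → N.vars = ∅ →
      (ite M N P Q).WF → Red E conv (ite M N P Q) Q
  | choose {P Q : Proc S} : (choice P Q).WF → Red E conv (choice P Q) P
  | comm {M N : Term S} {x : ℕ} {P Q : Proc S} : Q.NoCapture x N →
      (par (out M N P) (inp M x Q)).WF →
      Red E conv (par (out M N P) (inp M x Q)) (par P (Q.subst x N))
  | struct {A A' B B' : Proc S} : StructEq E conv A A' → Red E conv A' B' →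
      StructEq E conv B' B → Red E conv A B
  | ctxPar {A A' B : Proc S} : Red E conv A A' → (par A B).WF → (par A' B).WF →
      Red E conv (par A B) (par A' B)
  | ctxRes (u : Ident) {A A' : Proc S} : Red E conv A A' → (res u A).WF → (res u A').WF →
      Red E conv (res u A) (res u A')
  | ctxChoice {P P' Q : Proc S} : Red E conv P P' → (choice P Q).WF → (choice P' Q).WF →
      Red E conv (choice P Q) (choice P' Q)

/-- Actions: the silent action, the input `M(N)` and the output `ν x. M⟨x⟩`. -/
inductive Action (S : Signature) : Type
  | silent : Action S
  | inp (M N : Term S) : Action S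
  | out (x : ℕ) (M : Term S) : Action S

namespace Action

/-- Names of an action. -/
def names : Action S → Finset ℕ
  | silent => ∅
  | inp M N => M.names ∪ N.names
  | out _ M => M.names

/-- Free variables of an action. -/
def fv : Action S → Finset ℕ
  | silent => ∅
  | inp M N => M.vars ∪ N.vars
  | out _ M => M.vars

/-- Restricted variables of an action. -/
def rv : Action S → Finset ℕ
  | silent => ∅
  | inp _ _ => ∅
  | out x _ => {x}

/-- `u` occurs in the action. -/
def Mentions (μ : Action S) : Ident → Prop
  | .name n => n ∈ μ.names
  | .var x => x ∈ μ.fv ∪ μ.rv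

/-- Numerical code of an action. -/
def code : Action S → ℕ
  | silent => Nat.pair 0 0
  | inp M N => Nat.pair 1 (Nat.pair M.code N.code)
  | out x M => Nat.pair 2 (Nat.pair x M.code)

end Action

/-- Labelled transitions (`conv = False`: derived without α-conversion). The silent action labels
no transition of this relation. -/
inductive Lab (E : Term S → Term S → Prop) (conv : Prop) : Proc S → Action S → Proc S → Prop
  | inp {M N : Term S} {x : ℕ} {P : Proc S} : P.NoCapture x N → (inp M x P).WF →
      Lab E conv (inp M x P) (.inp M N) (P.subst x N)
  | out {M N : Term S} {x : ℕ} {P : Proc S} : x ∉ (out M N P).fv → (out M N P).WF →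
      Lab E conv (out M N P) (.out x M) (par P (act x N))
  | res {u : Ident} {A A' : Proc S} {α : Action S} : Lab E conv A α A' → ¬ α.Mentions u →
      (res u A).WF → (res u A').WF → Lab E conv (res u A) α (res u A')
  | par {A A' B : Proc S} {α : Action S} : Lab E conv A α A' → Disjoint α.rv B.fv →
      (par A B).WF → (par A' B).WF → Lab E conv (par A B) α (par A' B)
  | struct {A A' B B' : Proc S} {α : Action S} : StructEq E conv A A' → Lab E conv A' α B' →
      StructEq E conv B' B → Lab E conv A α B

/-- Weak transitions: `⟹` for the silent action, `⟹ α⟶ ⟹` for a labelled action `α`. -/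
def Weak (E : Term S → Term S → Prop) (conv : Prop) (A : Proc S) (μ : Action S) (B : Proc S) :
    Prop :=
  match μ with
  | .silent => Relation.ReflTransGen (Red E conv) A B
  | α => ∃ A' B', Relation.ReflTransGen (Red E conv) A A' ∧ Lab E conv A' α B' ∧
      Relation.ReflTransGen (Red E conv) B' B

open Classical in
/-- The frame of an extended process. -/
noncomputable def Proc.fr (A : Proc S) : Proc S :=
  if A.Plain then nil else
    match A with
    | par A B => par A.fr B.fr
    | res u A => res u A.fr
    | act x M => act x M
    | _ => nil

/-- The active substitution `{M₁/x₁} | … | {Mₙ/xₙ}`. -/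
def actList : List (ℕ × Term S) → Proc S
  | [] => nil
  | (x, M) :: σ => par (act x M) (actList σ)

/-- The same list as an ordinary substitution on terms. -/
def substList : List (ℕ × Term S) → ℕ → Term S
  | [], y => Term.var y
  | (x, M) :: σ, y => if y = x then M else substList σ y

/-- `ν n₁ … ν nₖ. A` -/
def resNames (ns : List ℕ) (A : Proc S) : Proc S := ns.foldr (fun n B => res (.name n) B) A

/-- `(M = N)φ` for a frame `φ`. -/
def EqIn (E : Term S → Term S → Prop) (φ : Proc S) (M N : Term S) : Prop :=
  M.vars ∪ N.vars ⊆ φ.dom ∧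
  ∃ (ns : List ℕ) (σ : List (ℕ × Term S)),
    StructEq E True φ (resNames ns (actList σ)) ∧
    (∀ n ∈ ns, n ∉ M.names ∪ N.names) ∧
    E (M.subst (substList σ)) (N.subst (substList σ))

/-- Static equivalence of closed processes: static equivalence of their frames. -/
def StaticEq (E : Term S → Term S → Prop) (A B : Proc S) : Prop :=
  A.fr.dom = B.fr.dom ∧ ∀ M N : Term S, EqIn E A.fr M N ↔ EqIn E B.fr M N

/-- The steps `(μ₁, A₁), …, (μₙ, Aₙ)` form a trace `A ⟹ A₁ ⟹ … ⟹ Aₙ` that starts at `A`. -/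
def IsTrace (E : Term S → Term S → Prop) (conv : Prop) : Proc S → List (Action S × Proc S) → Prop
  | A, [] => A.WF ∧ A.Closed
  | A, (μ, A') :: t => A.WF ∧ A.Closed ∧ μ.fv ⊆ A.dom ∧ Weak E conv A μ A' ∧
      IsTrace E conv A' t

/-- The steps `t` form a safe trace of `A`: all transitions are derived without α-conversion and no
action contains a bound name or a restricted variable of `A`. -/
def SafeTrace (E : Term S → Term S → Prop) (A : Proc S) (t : List (Action S × Proc S)) : Prop :=
  IsTrace E False A t ∧
  ∀ s ∈ t, Disjoint s.1.names A.bn ∧ Disjoint (s.1.fv ∪ s.1.rv) A.rv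

/-- Static equivalence of the traces that start at `A` with steps `t` and at `B` with
steps `t'`. -/
def TraceEquiv (E : Term S → Term S → Prop) (A : Proc S) (t : List (Action S × Proc S))
    (B : Proc S) (t' : List (Action S × Proc S)) : Prop :=
  StaticEq E A B ∧ List.Forall₂ (fun s s' => s.1 = s'.1 ∧ StaticEq E s.2 s'.2) t t'

/-- Numerical code of an instance: the processes `A`, `B` and a trace of `B` with steps `t`. -/
def instCode (A B : Proc S) (t : List (Action S × Proc S)) : ℕ :=
  Nat.pair A.code (Nat.pair B.code
    (Encodable.encode (t.map fun s => Nat.pair s.1.code s.2.code)))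

/-- The trace matching problem, on closed extended processes in the class `C`, is decidable: some
algorithm, given closed `A`, `B` in `C` and a safe trace of `B`, halts and tells whether `A` has a
safe trace that is statically equivalent to the given one. (Nothing is asked of the algorithm on
numbers that do not code an instance.) -/
def TraceProblemDecidable (E : Term S → Term S → Prop) (C : Proc S → Prop) : Prop :=
  ∃ f : ℕ →. ℕ, Nat.Partrec f ∧
    ∀ (A B : Proc S) (t : List (Action S × Proc S)),
      A.WF → B.WF → A.Closed → B.Closed → C A → C B → SafeTrace E B t →
      ((∃ t', SafeTrace E A t' ∧ TraceEquiv E B t A t') → 1 ∈ f (instCode A B t)) ∧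
      ((¬ ∃ t', SafeTrace E A t' ∧ TraceEquiv E B t A t') → 0 ∈ f (instCode A B t))

end AppliedPi

/-! The halting problem reduces to trace matching. An abstract machine that evaluates
`Turing.ToPartrec.Code` in continuation-passing style is written into a finite equational theory:
configurations are terms, and a unary symbol `step` is specified by finitely many name-free
equations. For a start configuration M, the process A = ν a. (a⟨M⟩ | !a(x). if x = halted then c⟨c⟩
else a⟨step(x)⟩) runs the machine and outputs on the free channel c only when it has halted. B is
the same process started at `halted`, with the one-step trace that signals on c. Both signals lead
to the same process, and plain processes have empty frames, so A matches the trace iff the machine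
halts on M.

If the machine halts, the reductions of A are written down explicitly (`steps_run`,
`loopFrom_match`). For the converse one must bound everything A can do modulo structural equivalence
and the theory. Instead of analysing derivations, terms are interpreted in an algebra that satisfies
the equations, and `Proc.Confined` is an invariant: all outputs go to the value of a and carry
values from the orbit of M under `step`. It is preserved by structural equivalence without
α-conversion and by reduction (`StructEq.confined_iff`, `Red.confined`), and it excludes an output
on c (`Lab.not_confined`). If `halted` is not in the orbit, A is confined. The algebra of
constructor terms `Val` serves as the model. It separates the names and makes `step` compute, so
confluence of the equations is never needed; there, reaching `halted` means that the evaluation is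
defined (`Val.exists_mem_eval_of_iterate_step`).

A single code with undecidable halting set suffices, so an instance varies only in one numeral. -/

namespace AppliedPi

open Function Relation

/-- An algebra for a signature, together with an interpretation of the names. -/
structure Algebra (S : Signature) (D : Type) where
  name : ℕ → D
  op : (f : Fin S.numSymbols) → (Fin (S.arity f) → D) → D

/-! ### Interpretation in an algebra and the confinement invariant -/

section Semantics

variable {S : Signature} {D : Type} (I : Algebra S D)

/-- The value of a term under a valuation of the variables. -/
def Term.eval (ρ : ℕ → D) : Term S → D
  | .name n => I.name n
  | .var x => ρ x
  | .app f args => I.op f fun i => (args i).eval ρ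

theorem Term.eval_congr {ρ ρ' : ℕ → D} {M : Term S} (h : ∀ x ∈ M.vars, ρ x = ρ' x) :
    M.eval I ρ = M.eval I ρ' := by
  induction M with
  | name n => rfl
  | var x => exact h x (by simp [Term.vars])
  | app f args ih =>
    simp only [Term.eval]
    congr 1
    funext i
    refine ih i fun x hx => h x ?_
    simp only [Term.vars, Finset.mem_biUnion, Finset.mem_univ, true_and]
    exact ⟨i, hx⟩

theorem Term.eval_update {ρ : ℕ → D} {M : Term S} {x : ℕ} {d : D} (h : x ∉ M.vars) :
    M.eval I (update ρ x d) = M.eval I ρ :=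
  Term.eval_congr I fun _ hy => update_of_ne (ne_of_mem_of_not_mem hy h) _ _

theorem Term.eval_subst (ρ : ℕ → D) (σ : ℕ → Term S) (M : Term S) :
    (M.subst σ).eval I ρ = M.eval I fun x => (σ x).eval I ρ := by
  induction M with
  | name n => rfl
  | var x => rfl
  | app f args ih => simp only [Term.subst, Term.eval, ih]

theorem Term.eval_subst_single (ρ : ℕ → D) (x : ℕ) (N M : Term S) :
    (M.subst (single x N)).eval I ρ = M.eval I (update ρ x (N.eval I ρ)) := by
  rw [Term.eval_subst]
  congr 1
  funext y
  by_cases h : y = x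
  · subst h; simp [single]
  · simp [single, h, Term.eval]

/-- The equations `ax` hold in the algebra `I`. -/
def Algebra.Models (ax : List (Term S × Term S)) : Prop :=
  ∀ e ∈ ax, ∀ ρ : ℕ → D, e.1.eval I ρ = e.2.eval I ρ

variable {I} in
theorem Algebra.Models.sound {ax : List (Term S × Term S)} (hI : I.Models ax) {M N : Term S}
    (h : EqTheory ax M N) (ρ : ℕ → D) : M.eval I ρ = N.eval I ρ := by
  induction h with
  | ax e he σ => rw [Term.eval_subst, Term.eval_subst]; exact hI e he _
  | refl M => rfl
  | symm _ ih => exact ih.symm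
  | trans _ _ ih₁ ih₂ => exact ih₁.trans ih₂
  | congr f _ ih => simp only [Term.eval, ih]

variable (ch : D) (R : Set D)

/-- Under the valuation `ρ`, the process outputs only on the channel `ch`, and only values in `R`,
as long as it receives only values in `R` on `ch` and nothing on other channels. The `else`
branches of conditionals are always taken into account. -/
def Proc.Confined : Proc S → (ℕ → D) → Prop
  | .nil, _ => True
  | .out M N P, ρ => M.eval I ρ = ch ∧ N.eval I ρ ∈ R ∧ P.Confined ρ
  | .inp M x P, ρ => M.eval I ρ = ch → ∀ d ∈ R, P.Confined (update ρ x d)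
  | .ite M N P Q, ρ => (M.eval I ρ = N.eval I ρ → P.Confined ρ) ∧ Q.Confined ρ
  | .choice P Q, ρ => P.Confined ρ ∧ Q.Confined ρ
  | .par A B, ρ => A.Confined ρ ∧ B.Confined ρ
  | .repl P, ρ => P.Confined ρ
  | .res (.name _) A, ρ => A.Confined ρ
  | .res (.var x) A, ρ => ∃ d, A.Confined (update ρ x d)
  | .act x M, ρ => ρ x = M.eval I ρ

theorem Proc.confined_congr {A : Proc S} {ρ ρ' : ℕ → D} (h : ∀ x ∈ A.fv, ρ x = ρ' x) :
    A.Confined I ch R ρ ↔ A.Confined I ch R ρ' := by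
  have upd : ∀ {P : Proc S} {x : ℕ} {ρ ρ' : ℕ → D} (d : D), (∀ y ∈ P.fv \ {x}, ρ y = ρ' y) →
      ∀ y ∈ P.fv, update ρ x d y = update ρ' x d y := by
    intro P x ρ ρ' d h y hy
    by_cases e : y = x
    · subst e; simp
    · simpa [e] using h y (by simp [hy, e])
  induction A generalizing ρ ρ' with
  | nil => rfl
  | out M N P ih =>
    simp only [Proc.fv, Finset.mem_union] at h
    simp only [Proc.Confined]
    rw [Term.eval_congr I (M := M) fun x hx => h x (.inl (.inl hx)),
      Term.eval_congr I (M := N) fun x hx => h x (.inl (.inr hx)),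
      propext (ih fun x hx => h x (.inr hx))]
  | inp M x P ih =>
    simp only [Proc.fv, Finset.mem_union] at h
    simp only [Proc.Confined]
    rw [Term.eval_congr I (M := M) fun x hx => h x (.inl hx)]
    exact imp_congr_right fun _ => forall₂_congr fun d _ => ih (upd d fun y hy => h y (.inr hy))
  | ite M N P Q ihP ihQ =>
    simp only [Proc.fv, Finset.mem_union] at h
    simp only [Proc.Confined]
    rw [Term.eval_congr I (M := M) fun x hx => h x (.inl (.inl (.inl hx))),
      Term.eval_congr I (M := N) fun x hx => h x (.inl (.inl (.inr hx))),
      propext (ihP fun x hx => h x (.inl (.inr hx))), propext (ihQ fun x hx => h x (.inr hx))]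
  | choice P Q ihP ihQ =>
    simp only [Proc.fv, Finset.mem_union] at h
    simp only [Proc.Confined]
    rw [propext (ihP fun x hx => h x (.inl hx)), propext (ihQ fun x hx => h x (.inr hx))]
  | par P Q ihP ihQ =>
    simp only [Proc.fv, Finset.mem_union] at h
    simp only [Proc.Confined]
    rw [propext (ihP fun x hx => h x (.inl hx)), propext (ihQ fun x hx => h x (.inr hx))]
  | repl P ih => exact ih h
  | res u A ih =>
    cases u with
    | name n => exact ih h
    | var x => exact exists_congr fun d => ih (upd d h)
  | act x M =>
    simp only [Proc.fv, Finset.mem_union, Finset.mem_singleton] at h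
    simp only [Proc.Confined]
    rw [Term.eval_congr I (M := M) fun x hx => h x (.inl hx), h x (.inr rfl)]

theorem Proc.confined_update {A : Proc S} {ρ : ℕ → D} {x : ℕ} {d : D} (h : x ∉ A.fv) :
    A.Confined I ch R (update ρ x d) ↔ A.Confined I ch R ρ :=
  Proc.confined_congr I ch R fun _ hy => update_of_ne (ne_of_mem_of_not_mem hy h) _ _

/-- Needed below binders: where `x` is not free, `NoCapture` allows the binder to occur in `M`, and
only the vacuity of the substitution helps. -/
theorem Proc.subst_of_not_mem_fv {A : Proc S} {x : ℕ} {M : Term S} (h : x ∉ A.fv) :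
    A.subst x M = A := by
  have ht : ∀ N : Term S, x ∉ N.vars → N.subst (single x M) = N := by
    intro N hN
    induction N with
    | name n => rfl
    | var y =>
      have : y ≠ x := fun e => hN (by simp [Term.vars, e])
      simp [Term.subst, single, this]
    | app f args ih =>
      simp only [Term.vars, Finset.mem_biUnion, Finset.mem_univ, true_and, not_exists] at hN
      simp only [Term.subst, Term.app.injEq, heq_eq_eq, true_and]
      exact funext fun i => ih i (hN i)
  induction A with
  | nil => rfl
  | res u A ih =>
    cases u with
    | name n => simp_all [Proc.subst, Proc.fv]
    | var y =>
      by_cases e : y = x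
      · simp [Proc.subst, e]
      · have : x ∉ A.fv := fun hx => h (by simp [Proc.fv, hx, Ne.symm e])
        simp [Proc.subst, e, ih this]
  | inp K y P ih =>
    simp only [Proc.fv, Finset.mem_union, not_or] at h
    by_cases e : y = x
    · simp [Proc.subst, e, ht K h.1]
    · have : x ∉ P.fv := fun hx => h.2 (by simp [hx, Ne.symm e])
      simp [Proc.subst, e, ih this, ht K h.1]
  | _ => simp_all [Proc.subst, Proc.fv]

theorem Proc.Plain.wf_dom_dep {A : Proc S} (h : A.Plain) :
    A.WF ∧ A.dom = ∅ ∧ ∀ x y, ¬ A.Dep x y := by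
  induction A with
  | par A B ihA ihB =>
    obtain ⟨hA, dA, eA⟩ := ihA h.1
    obtain ⟨hB, dB, eB⟩ := ihB h.2
    have e : ∀ x y, ¬ (Proc.par A B).Dep x y := by
      intro x y hxy
      induction hxy with
      | single h => exact h.elim (eA _ _) (eB _ _)
      | tail _ h _ => exact h.elim (eA _ _) (eB _ _)
    exact ⟨⟨hA, hB, by simp [dA], fun x => e x x⟩, by simp [Proc.dom, dA, dB], e⟩
  | res u A ih =>
    cases u with
    | name n => exact ih h
    | var x => exact h.elim
  | act x M => exact h.elim
  | _ => simp_all [Proc.WF, Proc.dom, Proc.Dep, Proc.Plain]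

theorem Proc.Plain.wf {A : Proc S} (h : A.Plain) : A.WF := h.wf_dom_dep.1

theorem Proc.Plain.dom_eq {A : Proc S} (h : A.Plain) : A.dom = ∅ := h.wf_dom_dep.2.1

/-- Substituting a term amounts to updating the valuation by its value. The condition `x ∉ A.dom` is
essential, because `subst` leaves the left-hand side of an active substitution untouched; below
prefixes it is automatic, since plain processes have empty domain. -/
theorem Proc.confined_subst {A : Proc S} {x : ℕ} {M : Term S} (hA : A.WF) (hx : x ∉ A.dom)
    (hc : A.NoCapture x M) (ρ : ℕ → D) :
    (A.subst x M).Confined I ch R ρ ↔ A.Confined I ch R (update ρ x (M.eval I ρ)) := by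
  -- The binder case: the two updates commute, and the value of `M` does not depend on the bound `y`
  -- unless `x` is not free, in which case neither side depends on `x`.
  have upd : ∀ {P : Proc S} {y : ℕ} {ρ : ℕ → D} (d : D), (x ∈ P.fv → y ∉ M.vars) → y ≠ x →
      (∀ ρ, (P.subst x M).Confined I ch R ρ ↔
        P.Confined I ch R (update ρ x (M.eval I ρ))) →
      ((P.subst x M).Confined I ch R (update ρ y d) ↔
        P.Confined I ch R (update (update ρ x (M.eval I ρ)) y d)) := by
    intro P y ρ d hxy hne ih
    rw [update_comm hne.symm]
    by_cases hP : x ∈ P.fv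
    · rw [ih, Term.eval_update I (hxy hP)]
    · rw [Proc.subst_of_not_mem_fv hP, Proc.confined_update I ch R hP]
  induction A generalizing ρ with
  | nil => rfl
  | out K N P ih =>
    have hP : P.Plain := hA
    simp only [Proc.subst, Proc.Confined, Term.eval_subst_single,
      ih hP.wf (by simp [hP.dom_eq]) hc]
  | inp K y P ih =>
    have hP : P.Plain := hA
    simp only [Proc.subst, Proc.Confined, Term.eval_subst_single]
    refine imp_congr_right fun _ => forall₂_congr fun d _ => ?_
    by_cases e : y = x
    · subst e; simp
    · have hc := hc.resolve_left e
      rw [if_neg e]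
      exact upd d hc.2 e (ih hP.wf (by simp [hP.dom_eq]) hc.1)
  | ite K N P Q ihP ihQ =>
    have hP : P.Plain := hA.1
    have hQ : Q.Plain := hA.2
    simp only [Proc.subst, Proc.Confined, Term.eval_subst_single,
      ihP hP.wf (by simp [hP.dom_eq]) hc.1, ihQ hQ.wf (by simp [hQ.dom_eq]) hc.2]
  | choice P Q ihP ihQ =>
    have hP : P.Plain := hA.1
    have hQ : Q.Plain := hA.2
    simp only [Proc.subst, Proc.Confined,
      ihP hP.wf (by simp [hP.dom_eq]) hc.1, ihQ hQ.wf (by simp [hQ.dom_eq]) hc.2]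
  | par P Q ihP ihQ =>
    simp only [Proc.dom, Finset.mem_union, not_or] at hx
    simp only [Proc.subst, Proc.Confined, ihP hA.1 hx.1 hc.1, ihQ hA.2.1 hx.2 hc.2]
  | repl P ih =>
    have hP : P.Plain := hA
    exact ih hP.wf (by simp [hP.dom_eq]) hc ρ
  | res u A ih =>
    cases u with
    | name n => exact ih hA hx hc.1 ρ
    | var y =>
      simp only [Proc.subst, Proc.Confined]
      refine exists_congr fun d => ?_
      by_cases e : y = x
      · subst e; simp
      · have hc := hc.resolve_left e
        rw [if_neg e]
        refine upd d hc.2 e (ih hA.1 (fun h => hx ?_) hc.1)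
        simp [Proc.dom, h, Ne.symm e]
  | act y N =>
    have : y ≠ x := fun e => hx (by simp [Proc.dom, e])
    simp [Proc.subst, Proc.Confined, Term.eval_subst_single, this]

variable {I ch R} {ax : List (Term S × Term S)}

/-- Every law is valid for valuations: a restricted variable is an existential quantifier, an active
substitution an equation, and parallel composition a conjunction. α-conversion of names would break
this, since each name has a fixed value which its restriction does not rebind. -/
theorem StructEq.confined_iff (hI : I.Models ax) {A B : Proc S}
    (h : StructEq (EqTheory ax) False A B) (ρ : ℕ → D) :
    A.Confined I ch R ρ ↔ B.Confined I ch R ρ := by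
  induction h generalizing ρ with
  | refl _ => rfl
  | symm _ ih => exact (ih ρ).symm
  | trans _ _ ih₁ ih₂ => exact (ih₁ ρ).trans (ih₂ ρ)
  | alpha h => exact h.elim
  | ctxPar _ _ _ ih => exact and_congr_left' (ih ρ)
  | ctxRes u _ _ _ ih =>
    cases u with
    | name n => exact ih ρ
    | var x => exact exists_congr fun d => ih _
  | ctxChoice _ _ _ ih => exact and_congr_left' (ih ρ)
  | parNil => simp [Proc.Confined]
  | parAssoc => exact and_assoc
  | parComm => exact and_comm
  | @scope u A B hu _ _ =>
    cases u with
    | name n => rfl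
    | var x => simp [Proc.Confined, Proc.confined_update I ch R (A := B) hu]
  | @resComm u v A _ _ =>
    cases u with
    | name n => cases v <;> rfl
    | var x =>
      cases v with
      | name m => rfl
      | var y =>
        by_cases e : x = y
        · subst e; rfl
        · simp only [Proc.Confined]
          rw [exists_comm]
          simp only [update_comm e]
  | repl => simp [Proc.Confined]
  | choiceComm => exact and_comm
  | @hide x M h =>
    simp only [Proc.Confined, iff_true]
    -- Well-formedness keeps `x` out of `M`, so the value of `M` solves the equation.
    refine ⟨M.eval I ρ, ?_⟩
    rw [Term.eval_update I h.1]
    simp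
  | @subst A x M hc h _ =>
    simp only [Proc.Confined, and_congr_left_iff]
    intro hx
    -- The active substitution already forces `ρ x` to be the value of `M`, so the update changes
    -- nothing once `x` is known to be outside the domain of `A`.
    have hd : x ∉ A.dom := fun hA =>
      Finset.disjoint_left.1 h.2.2.1 hA (by simp [Proc.dom])
    rw [Proc.confined_subst I ch R h.1 hd hc, ← hx, update_eq_self]
  | rewrite hMN => simp only [Proc.Confined, hI.sound hMN]

/-- In a communication the sender's channel has value `ch` and its message lies in `R`, which is
what the receiver assumes. An equation that fails in the theory may still hold in the model; hence
`Confined` demands the `else` branch unconditionally, while the `then` branch may rely on soundness.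
-/
theorem Red.confined (hI : I.Models ax) {A B : Proc S}
    (h : Red (EqTheory ax) False A B) {ρ : ℕ → D} (hA : A.Confined I ch R ρ) :
    B.Confined I ch R ρ := by
  induction h generalizing ρ with
  | ifTrue hMN => exact hA.1 (hI.sound hMN ρ)
  | ifFalse => exact hA.2
  | choose => exact hA.1
  | @comm M N x P Q hc h =>
    have hQ : Q.Plain := h.2.1
    refine ⟨hA.1.2.2, ?_⟩
    rw [Proc.confined_subst I ch R hQ.wf (by simp [hQ.dom_eq]) hc]
    exact hA.2 hA.1.1 _ hA.1.2.1
  | struct h₁ _ h₂ ih => exact (h₂.confined_iff hI ρ).1 (ih ((h₁.confined_iff hI ρ).1 hA))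
  | ctxPar _ _ _ ih => exact ⟨ih hA.1, hA.2⟩
  | ctxRes u _ _ _ ih =>
    cases u with
    | name n => exact ih hA
    | var x => exact hA.imp fun d hd => ih hd
  | ctxChoice _ _ _ ih => exact ⟨ih hA.1, hA.2⟩

theorem Lab.not_confined (hI : I.Models ax) {A B : Proc S} {x n : ℕ} (hn : I.name n ≠ ch)
    (h : Lab (EqTheory ax) False A (.out x (.name n)) B) (ρ : ℕ → D) :
    ¬ A.Confined I ch R ρ := by
  generalize hα : Action.out x (Term.name n) = α at h
  induction h generalizing ρ with
  | inp => cases hα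
  | out => cases hα; exact fun hA => hn hA.1
  | @res u _ _ _ _ _ _ _ ih =>
    cases u with
    | name m => exact ih ρ hα
    | var y => exact fun ⟨d, hd⟩ => ih _ hα hd
  | par _ _ _ _ ih => exact fun hA => ih ρ hα hA.1
  | struct h₁ _ _ ih => exact fun hA => ih ρ hα ((h₁.confined_iff hI ρ).1 hA)

end Semantics

/-! ### Processes that iterate a function on terms -/

section Loop

variable {S : Signature}

/-- The process `a(x). if x = h then c⟨c⟩ else a⟨T⟩`, where `x` may occur in `T`. -/
def loopBody (T h : Term S) : Proc S :=
  .inp (.name 0) 0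
    (.ite (.var 0) h (.out (.name 1) (.name 1) .nil) (.out (.name 0) T .nil))

/-- The process `ν a. (a⟨M⟩ | !a(x). if x = h then c⟨c⟩ else a⟨T⟩)`. It iterates the function
given by `T`, starting from `M`, until it arrives at `h`, and then signals on `c`. -/
def loopFrom (T h M : Term S) : Proc S :=
  .res (.name 0) (.par (.out (.name 0) M .nil) (.repl (loopBody T h)))

/-- The state of `loopFrom T h M` that is ready to signal. -/
def loopSignal (T h : Term S) : Proc S :=
  .res (.name 0) (.par (.out (.name 1) (.name 1) .nil) (.repl (loopBody T h)))

/-- The state of `loopFrom T h M` after the signal. -/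
def loopEnd (T h : Term S) : Proc S :=
  .res (.name 0) (.par (.par .nil (.act 1 (.name 1))) (.repl (loopBody T h)))

theorem loopBody_plain (T h : Term S) : (loopBody T h).Plain := ⟨trivial, trivial⟩

theorem loopFrom_plain (T h M : Term S) : (loopFrom T h M).Plain :=
  ⟨trivial, loopBody_plain T h⟩

theorem Term.subst_of_vars_eq_empty {M : Term S} (hM : M.vars = ∅) (σ : ℕ → Term S) :
    M.subst σ = M := by
  induction M with
  | name n => rfl
  | var x => simp [Term.vars] at hM
  | app f args ih =>
    simp only [Term.subst, Term.app.injEq, heq_eq_eq, true_and]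
    refine funext fun i => ih i (Finset.subset_empty.1 ?_)
    rw [← hM, Term.vars]
    exact Finset.subset_biUnion_of_mem (fun i => (args i).vars) (Finset.mem_univ i)

theorem Term.vars_subst_eq_empty {T : Term S} {σ : ℕ → Term S}
    (h : ∀ x ∈ T.vars, (σ x).vars = ∅) : (T.subst σ).vars = ∅ := by
  induction T with
  | name n => rfl
  | var x => exact h x (by simp [Term.vars])
  | app f args ih =>
    simp only [Term.subst, Term.vars]
    refine Finset.subset_empty.1 (Finset.biUnion_subset.2 fun i _ =>
      (ih i fun x hx => h x ?_).subset)
    simp only [Term.vars, Finset.mem_biUnion, Finset.mem_univ, true_and]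
    exact ⟨i, hx⟩

variable {T h M : Term S}

theorem loopBody_fv (hT : T.vars ⊆ {0}) (hh : h.vars = ∅) : (loopBody T h).fv = ∅ := by
  rcases Finset.subset_singleton_iff.1 hT with e | e <;>
    simp [loopBody, Proc.fv, Term.vars, hh, e]

theorem loopFrom_closed (hT : T.vars ⊆ {0}) (hh : h.vars = ∅) (hM : M.vars = ∅) :
    (loopFrom T h M).Closed := by
  simp [Proc.Closed, loopFrom, Proc.fv, Proc.dom, loopBody_fv hT hh, hM, Term.vars]

theorem loopEnd_wf (T h : Term S) : (loopEnd T h).WF := by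
  have e : ∀ x y, ¬ (Proc.par .nil (.act 1 (.name 1 : Term S))).Dep x y := by
    intro x y hxy
    induction hxy with
    | single h => simp [Proc.Dep, Term.vars] at h
    | tail _ h _ => simp [Proc.Dep, Term.vars] at h
  refine ⟨⟨trivial, by simp [Proc.WF, Term.vars], by simp [Proc.dom], fun x => e x x⟩,
    loopBody_plain T h, by simp [Proc.dom], fun x hx => ?_⟩
  have : ∀ x y, ¬ (Proc.par (.par .nil (.act 1 (.name 1))) (.repl (loopBody T h))).Dep x y := by
    intro x y hxy
    induction hxy with
    | single h => exact h.elim (e _ _) (by simp [Proc.Dep])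
    | tail _ h _ => exact h.elim (e _ _) (by simp [Proc.Dep])
  exact this x x hx

theorem loopEnd_closed (hT : T.vars ⊆ {0}) (hh : h.vars = ∅) : (loopEnd T h).Closed := by
  simp [Proc.Closed, loopEnd, Proc.fv, Proc.dom, loopBody_fv hT hh, Term.vars]

variable {E : Term S → Term S → Prop}

theorem StructEq.par_right {A B B' : Proc S} (hA : A.Plain) (hB : B.Plain) (hB' : B'.Plain)
    (h : StructEq E False B B') : StructEq E False (.par A B) (.par A B') :=
  have w : ∀ {P Q : Proc S}, P.Plain → Q.Plain → (Proc.par P Q).WF :=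
    fun hP hQ => Proc.Plain.wf ⟨hP, hQ⟩
  ((StructEq.parComm (w hA hB) (w hB hA)).trans (.ctxPar h (w hB hA) (w hB' hA))).trans
    (.parComm (w hB' hA) (w hA hB'))

theorem StructEq.nil_par {A : Proc S} (hA : A.Plain) : StructEq E False (.par .nil A) A :=
  have w₁ : (Proc.par .nil A).WF := Proc.Plain.wf ⟨trivial, hA⟩
  have w₂ : (Proc.par A .nil).WF := Proc.Plain.wf ⟨hA, trivial⟩
  (StructEq.parComm w₁ w₂).trans (.parNil hA.wf w₂)

/-- One copy of the replicated body is unfolded and receives `M` on the private channel. -/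
theorem loopFrom_red_ite (hh : h.vars = ∅) :
    Red E False (loopFrom T h M) (.res (.name 0) (.par (.par .nil
      (.ite M h (.out (.name 1) (.name 1) .nil) (.out (.name 0) (T.subst (single 0 M)) .nil)))
      (.repl (loopBody T h)))) := by
  have hP := loopBody_plain T h
  have hO : (Proc.out (.name 0) M .nil).Plain := trivial
  have hR : (Proc.repl (loopBody T h)).Plain := hP
  have hOP : (Proc.par (.out (.name 0) M .nil) (loopBody T h)).Plain := ⟨hO, hP⟩
  have hX : (Proc.par .nil (.ite M h (.out (.name 1) (.name 1) .nil)
      (.out (.name 0) (T.subst (single 0 M)) .nil))).Plain := ⟨trivial, trivial, trivial⟩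
  have hPR : (Proc.par (loopBody T h) (.repl (loopBody T h))).Plain := ⟨hP, hR⟩
  have wl : (Proc.par (.par (.out (.name 0) M .nil) (loopBody T h))
      (.repl (loopBody T h))).WF := Proc.Plain.wf ⟨hOP, hR⟩
  have wx : (Proc.par (Proc.par .nil (.ite M h (.out (.name 1) (.name 1) .nil)
      (.out (.name 0) (T.subst (single 0 M)) .nil))) (.repl (loopBody T h))).WF :=
    Proc.Plain.wf ⟨hX, hR⟩
  refine .ctxRes _ (.struct (((StructEq.repl hR.wf hPR.wf).par_right hO hR hPR).trans
    (.symm (.parAssoc wl (Proc.Plain.wf ⟨hO, hPR⟩)))) (.ctxPar ?_ wl wx) (.refl wx))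
    (loopFrom_plain T h M).wf wx
  convert Red.comm (E := E) (conv := False) (M := .name 0) (N := M) (x := 0) (P := .nil)
    (Q := .ite (.var 0) h (.out (.name 1) (.name 1) .nil) (.out (.name 0) T .nil))
    ⟨trivial, trivial⟩ hOP.wf using 2
  · rfl
  · simp [Proc.subst, Term.subst, single, Term.subst_of_vars_eq_empty hh]

theorem red_of_ite {X Y : Proc S} {Q : Proc S} (hX : X.Plain) (hY : Y.Plain) (hQ : Q.Plain)
    (h : Red E False X Y) :
    Red E False (.res (.name 0) (.par (.par .nil X) Q)) (.res (.name 0) (.par Y Q)) :=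
  have w : (Proc.par (.par .nil X) Q).WF := Proc.Plain.wf ⟨⟨trivial, hX⟩, hQ⟩
  have w' : (Proc.par Y Q).WF := Proc.Plain.wf ⟨hY, hQ⟩
  .ctxRes _ (.ctxPar (.struct (.nil_par hX) h (.refl hY.wf)) w w') w w'

theorem loopFrom_reds_next (hh : h.vars = ∅) (hM : M.vars = ∅) (hE : ¬ E M h) :
    ReflTransGen (Red E False) (loopFrom T h M) (loopFrom T h (T.subst (single 0 M))) :=
  .tail (.single (loopFrom_red_ite hh)) (red_of_ite ⟨trivial, trivial⟩ trivial
    (loopBody_plain T h) (.ifFalse hE hM hh ⟨trivial, trivial⟩))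

theorem loopFrom_reds_signal_of_eq (hh : h.vars = ∅) (hE : E M h) :
    ReflTransGen (Red E False) (loopFrom T h M) (loopSignal T h) :=
  .tail (.single (loopFrom_red_ite hh)) (red_of_ite ⟨trivial, trivial⟩ trivial
    (loopBody_plain T h) (.ifTrue hE ⟨trivial, trivial⟩))

/-- The loop may stop before the `n`-th iterate, namely as soon as an iterate equals `h` in the
theory. The iterates stay ground, as the rule for the `else` branch requires. -/
theorem loopFrom_reds_signal (hT : T.vars ⊆ {0}) (hh : h.vars = ∅) {n : ℕ} (hM : M.vars = ∅)
    (hn : E ((fun N => T.subst (single 0 N))^[n] M) h) :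
    ReflTransGen (Red E False) (loopFrom T h M) (loopSignal T h) := by
  induction n generalizing M with
  | zero => exact loopFrom_reds_signal_of_eq hh hn
  | succ n ih =>
    by_cases hE : E M h
    · exact loopFrom_reds_signal_of_eq hh hE
    · refine (loopFrom_reds_next hh hM hE).trans (ih (Term.vars_subst_eq_empty fun x hx => ?_) hn)
      rw [Finset.mem_singleton.1 (hT hx)]
      simpa [single] using hM

theorem loopSignal_lab (hT : T.vars ⊆ {0}) (hh : h.vars = ∅) :
    Lab E False (loopSignal T h) (.out 1 (.name 1)) (loopEnd T h) := by
  have w : (Proc.par (.out (.name 1) (.name 1) .nil) (.repl (loopBody T h))).WF :=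
    Proc.Plain.wf ⟨trivial, loopBody_plain T h⟩
  refine .res (.par (.out ?_ trivial) ?_ w (loopEnd_wf T h)) ?_ w (loopEnd_wf T h)
  · simp [Proc.fv, Term.vars]
  · simp [Action.rv, Proc.fv, loopBody_fv hT hh]
  · simp [Action.Mentions, Action.names, Term.names]

theorem loopFrom_safeTrace (hT : T.vars ⊆ {0}) (hh : h.vars = ∅) {n : ℕ} (hM : M.vars = ∅)
    (hn : E ((fun N => T.subst (single 0 N))^[n] M) h) :
    SafeTrace E (loopFrom T h M) [(.out 1 (.name 1), loopEnd T h)] := by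
  refine ⟨⟨(loopFrom_plain T h M).wf, loopFrom_closed hT hh hM, by simp [Action.fv, Term.vars],
    ⟨_, _, loopFrom_reds_signal hT hh hM hn, loopSignal_lab hT hh, .refl⟩,
    loopEnd_wf T h, loopEnd_closed hT hh⟩, ?_⟩
  simp [Action.names, Term.names, loopFrom, loopBody, Proc.bn, Proc.rv]

theorem staticEq_refl (A : Proc S) : StaticEq E A A := ⟨rfl, fun _ _ => .rfl⟩

theorem Proc.Plain.fr_eq {A : Proc S} (hA : A.Plain) : A.fr = .nil := by
  cases A <;> simp [Proc.fr, hA]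

theorem Proc.Plain.staticEq {A B : Proc S} (hA : A.Plain) (hB : B.Plain) : StaticEq E A B := by
  rw [StaticEq, hA.fr_eq, hB.fr_eq]
  exact ⟨rfl, fun _ _ => .rfl⟩

/-- The state after the signal does not remember the starting term, so the two traces end in the
same process; at the start both frames are `nil`. -/
theorem loopFrom_match (hT : T.vars ⊆ {0}) (hh : h.vars = ∅) {n : ℕ} (hM : M.vars = ∅)
    (hn : E ((fun N => T.subst (single 0 N))^[n] M) h) :
    ∃ t, SafeTrace E (loopFrom T h M) t ∧
      TraceEquiv E (loopFrom T h h) [(.out 1 (.name 1), loopEnd T h)] (loopFrom T h M) t :=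
  ⟨_, loopFrom_safeTrace hT hh hM hn, (loopFrom_plain T h h).staticEq (loopFrom_plain T h M),
    .cons ⟨rfl, staticEq_refl _⟩ .nil⟩

/-- By contraposition: if the orbit of the starting value misses `h`, the loop is confined to its
private channel and cannot make the output on `name 1` that the trace begins with. -/
theorem exists_iterate_eq_of_loopFrom_match {D : Type} {I : Algebra S D}
    {ax : List (Term S × Term S)} (hI : I.Models ax) (hne : I.name 1 ≠ I.name 0)
    (hh : h.vars = ∅) (ρ : ℕ → D)
    (hm : ∃ t, SafeTrace (EqTheory ax) (loopFrom T h M) t ∧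
      TraceEquiv (EqTheory ax) (loopFrom T h h) [(.out 1 (.name 1), loopEnd T h)]
        (loopFrom T h M) t) :
    ∃ n, (fun d => T.eval I (update ρ 0 d))^[n] (M.eval I ρ) = h.eval I ρ := by
  by_contra! hno
  obtain ⟨t, ⟨ht, -⟩, -, he⟩ := hm
  obtain ⟨⟨μ, A⟩, t, ⟨rfl, -⟩, -, rfl⟩ := List.forall₂_cons_left_iff.1 he
  obtain ⟨-, -, -, ⟨A', B', hA, hl, -⟩, -⟩ := ht
  -- The orbit is closed under `T`, which confines the `else` branch, and misses the value of `h`,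
  -- which makes the signalling branch vacuous.
  let R : Set D := {d | ∃ n, (fun d => T.eval I (update ρ 0 d))^[n] (M.eval I ρ) = d}
  have hc : (loopFrom T h M).Confined I (I.name 0) R ρ := by
    refine ⟨⟨rfl, ⟨0, rfl⟩, trivial⟩, fun _ d hd => ⟨fun e => ?_, rfl, ?_, trivial⟩⟩
    · obtain ⟨n, rfl⟩ := hd
      refine absurd ?_ (hno n)
      rw [Term.eval_update I (M := h) (by simp [hh])] at e
      simpa [Term.eval] using e
    · obtain ⟨n, rfl⟩ := hd
      exact ⟨n + 1, iterate_succ_apply' _ _ _⟩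
  refine hl.not_confined hI hne ρ (ch := I.name 0) (R := R) ?_
  clear hl
  induction hA with
  | refl => exact hc
  | tail _ h ih => exact h.confined hI ih

end Loop

/-! ### The signature and the equations of the abstract machine -/

/-- The arities of the symbols of `machineSig`. -/
def machineArity : Fin 22 → ℕ :=
  ![0, 1, 0, 2, 0, 0, 0, 2, 2, 2, 1, 0, 3, 2, 2, 2, 0, 2, 3, 1, 1, 1]

/-- The signature of the abstract machine that evaluates `Turing.ToPartrec.Code`: numbers, lists,
codes, continuations, configurations, and the functions `step`, `head` and `tail`. -/
def machineSig : Signature := ⟨22, machineArity⟩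

namespace Machine

abbrev Tm := Term machineSig

section Operations

variable (f : Fin 22)

/-- The argument family is indexed by an empty type; `.var 0` is a dummy that never occurs in the
term. -/
def op₀ (_ : machineArity f = 0) : Tm := .app (S := machineSig) f fun _ => .var 0

def op₁ (_ : machineArity f = 1) (x : Tm) : Tm := .app (S := machineSig) f fun _ => x

def op₂ (h : machineArity f = 2) (x y : Tm) : Tm :=
  .app (S := machineSig) f fun i => ![x, y] (Fin.cast h i)

def op₃ (h : machineArity f = 3) (x y z : Tm) : Tm :=
  .app (S := machineSig) f fun i => ![x, y, z] (Fin.cast h i)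

variable {f}

theorem forall_fin_cast {m n : ℕ} (h : m = n) {p : Fin n → Prop} :
    (∀ i : Fin m, p (Fin.cast h i)) ↔ ∀ i, p i := by
  subst h; rfl

theorem exists_fin_cast {m n : ℕ} (h : m = n) {p : Fin n → Prop} :
    (∃ i : Fin m, p (Fin.cast h i)) ↔ ∃ i, p i := by
  subst h; rfl

theorem subst_op₀ (h) (σ : ℕ → Tm) : (op₀ f h).subst σ = op₀ f h := by
  simp only [op₀, Term.subst]
  congr 1
  funext i
  exact (Fin.cast h i).elim0

theorem subst_op₁ (h) (σ : ℕ → Tm) (x : Tm) : (op₁ f h x).subst σ = op₁ f h (x.subst σ) := rfl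

theorem subst_op₂ (h) (σ : ℕ → Tm) (x y : Tm) :
    (op₂ f h x y).subst σ = op₂ f h (x.subst σ) (y.subst σ) :=
  congrArg (Term.app (S := machineSig) f) (funext ((forall_fin_cast h
    (p := fun i => (![x, y] i).subst σ = ![x.subst σ, y.subst σ] i)).2
    (Fin.forall_fin_two.2 ⟨rfl, rfl⟩)))

theorem subst_op₃ (h) (σ : ℕ → Tm) (x y z : Tm) :
    (op₃ f h x y z).subst σ = op₃ f h (x.subst σ) (y.subst σ) (z.subst σ) :=
  congrArg (Term.app (S := machineSig) f) (funext ((forall_fin_cast h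
    (p := fun i => (![x, y, z] i).subst σ = ![x.subst σ, y.subst σ, z.subst σ] i)).2
    (Fin.forall_fin_succ.2 ⟨rfl, Fin.forall_fin_two.2 ⟨rfl, rfl⟩⟩)))

variable {ax : List (Tm × Tm)}

theorem congr_op₁ (h) {x x' : Tm} (hx : EqTheory ax x x') :
    EqTheory ax (op₁ f h x) (op₁ f h x') :=
  .congr (S := machineSig) f fun _ => hx

theorem congr_op₂ (h) {x x' y y' : Tm} (hx : EqTheory ax x x') (hy : EqTheory ax y y') :
    EqTheory ax (op₂ f h x y) (op₂ f h x' y') :=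
  .congr (S := machineSig) f ((forall_fin_cast h
    (p := fun i => EqTheory ax (![x, y] i) (![x', y'] i))).2 (Fin.forall_fin_two.2 ⟨hx, hy⟩))

theorem names_op₀ (h) : (op₀ f h).names = ∅ := by
  ext a
  simp only [op₀, Term.names, Finset.mem_biUnion, Finset.mem_univ, true_and, Finset.notMem_empty,
    iff_false, not_exists]
  exact fun i => (Fin.cast h i).elim0

theorem names_op₁ (h) (x : Tm) : (op₁ f h x).names = x.names := by
  ext a
  simp only [op₁, Term.names, Finset.mem_biUnion, Finset.mem_univ, true_and, exists_const_iff]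
  exact and_iff_right ⟨Fin.cast h.symm 0⟩

theorem names_op₂ (h) (x y : Tm) : (op₂ f h x y).names = x.names ∪ y.names := by
  ext a
  simp only [op₂, Term.names, Finset.mem_biUnion, Finset.mem_univ, true_and, Finset.mem_union]
  exact (exists_fin_cast h (p := fun i => a ∈ (![x, y] i).names)).trans Fin.exists_fin_two

theorem names_op₃ (h) (x y z : Tm) :
    (op₃ f h x y z).names = x.names ∪ (y.names ∪ z.names) := by
  ext a
  simp only [op₃, Term.names, Finset.mem_biUnion, Finset.mem_univ, true_and, Finset.mem_union]
  exact (exists_fin_cast h (p := fun i => a ∈ (![x, y, z] i).names)).trans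
    (Fin.exists_fin_succ.trans (or_congr_right Fin.exists_fin_two))

theorem vars_op₀ (h) : (op₀ f h).vars = ∅ := by
  ext a
  simp only [op₀, Term.vars, Finset.mem_biUnion, Finset.mem_univ, true_and, Finset.notMem_empty,
    iff_false, not_exists]
  exact fun i => (Fin.cast h i).elim0

theorem vars_op₁ (h) (x : Tm) : (op₁ f h x).vars = x.vars := by
  ext a
  simp only [op₁, Term.vars, Finset.mem_biUnion, Finset.mem_univ, true_and, exists_const_iff]
  exact and_iff_right ⟨Fin.cast h.symm 0⟩

theorem vars_op₂ (h) (x y : Tm) : (op₂ f h x y).vars = x.vars ∪ y.vars := by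
  ext a
  simp only [op₂, Term.vars, Finset.mem_biUnion, Finset.mem_univ, true_and, Finset.mem_union]
  exact (exists_fin_cast h (p := fun i => a ∈ (![x, y] i).vars)).trans Fin.exists_fin_two

theorem vars_op₃ (h) (x y z : Tm) :
    (op₃ f h x y z).vars = x.vars ∪ (y.vars ∪ z.vars) := by
  ext a
  simp only [op₃, Term.vars, Finset.mem_biUnion, Finset.mem_univ, true_and, Finset.mem_union]
  exact (exists_fin_cast h (p := fun i => a ∈ (![x, y, z] i).vars)).trans
    (Fin.exists_fin_succ.trans (or_congr_right Fin.exists_fin_two))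

theorem code_op₁ (h) (x : Tm) :
    (op₁ f h x).code = Nat.pair 2 (Nat.pair f (Encodable.encode [x.code])) := by
  simp only [op₁, Term.code]
  congr 3
  exact (List.ofFn_congr h _).trans (by simp)

theorem code_op₂ (h) (x y : Tm) :
    (op₂ f h x y).code = Nat.pair 2 (Nat.pair f (Encodable.encode [x.code, y.code])) := by
  simp only [op₂, Term.code]
  congr 3
  exact (List.ofFn_congr h _).trans (by simp)

theorem code_op₃ (h) (x y z : Tm) :
    (op₃ f h x y z).code = Nat.pair 2 (Nat.pair f (Encodable.encode [x.code, y.code, z.code])) := by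
  simp only [op₃, Term.code]
  congr 3
  exact (List.ofFn_congr h _).trans (by simp)

end Operations

abbrev zero : Tm := op₀ 0 (by decide)
abbrev succ (x : Tm) : Tm := op₁ 1 (by decide) x
abbrev nil : Tm := op₀ 2 (by decide)
abbrev cons (x v : Tm) : Tm := op₂ 3 (by decide) x v
abbrev codeZero : Tm := op₀ 4 (by decide)
abbrev codeSucc : Tm := op₀ 5 (by decide)
abbrev codeTail : Tm := op₀ 6 (by decide)
abbrev codeCons (f g : Tm) : Tm := op₂ 7 (by decide) f g
abbrev codeComp (f g : Tm) : Tm := op₂ 8 (by decide) f g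
abbrev codeCase (f g : Tm) : Tm := op₂ 9 (by decide) f g
abbrev codeFix (f : Tm) : Tm := op₁ 10 (by decide) f
abbrev contHalt : Tm := op₀ 11 (by decide)
abbrev contCons₁ (f v k : Tm) : Tm := op₃ 12 (by decide) f v k
abbrev contCons₂ (v k : Tm) : Tm := op₂ 13 (by decide) v k
abbrev contComp (f k : Tm) : Tm := op₂ 14 (by decide) f k
abbrev contFix (f k : Tm) : Tm := op₂ 15 (by decide) f k
abbrev halted : Tm := op₀ 16 (by decide)
/-- The configuration in which the list `v` is passed to the continuation `k`. -/
abbrev ret (k v : Tm) : Tm := op₂ 17 (by decide) k v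
/-- The configuration in which the code `c` is applied to the list `v`, with continuation `k`. -/
abbrev run (c k v : Tm) : Tm := op₃ 18 (by decide) c k v
abbrev step (x : Tm) : Tm := op₁ 19 (by decide) x
abbrev head (v : Tm) : Tm := op₁ 20 (by decide) v
abbrev tail (v : Tm) : Tm := op₁ 21 (by decide) v

/-- The instances under `σ` of the equations of the machine. -/
def equations (σ : ℕ → Tm) : List (Tm × Tm) :=
  [(head nil, zero),
   (head (cons (σ 0) (σ 1)), σ 0),
   (tail nil, nil),
   (tail (cons (σ 0) (σ 1)), σ 1),
   (step (run codeZero (σ 0) (σ 1)), ret (σ 0) (cons zero (σ 1))),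
   (step (run codeSucc (σ 0) (σ 1)), ret (σ 0) (cons (succ (head (σ 1))) nil)),
   (step (run codeTail (σ 0) (σ 1)), ret (σ 0) (tail (σ 1))),
   (step (run (codeCons (σ 2) (σ 3)) (σ 0) (σ 1)),
      run (σ 2) (contCons₁ (σ 3) (σ 1) (σ 0)) (σ 1)),
   (step (run (codeComp (σ 2) (σ 3)) (σ 0) (σ 1)), run (σ 3) (contComp (σ 2) (σ 0)) (σ 1)),
   (step (run (codeCase (σ 2) (σ 3)) (σ 0) nil), run (σ 2) (σ 0) nil),
   (step (run (codeCase (σ 2) (σ 3)) (σ 0) (cons zero (σ 1))), run (σ 2) (σ 0) (σ 1)),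
   (step (run (codeCase (σ 2) (σ 3)) (σ 0) (cons (succ (σ 4)) (σ 1))),
      run (σ 3) (σ 0) (cons (σ 4) (σ 1))),
   (step (run (codeFix (σ 2)) (σ 0) (σ 1)), run (σ 2) (contFix (σ 2) (σ 0)) (σ 1)),
   (step (ret contHalt (σ 1)), halted),
   (step (ret (contCons₁ (σ 2) (σ 3) (σ 0)) (σ 1)), run (σ 2) (contCons₂ (σ 1) (σ 0)) (σ 3)),
   (step (ret (contCons₂ (σ 2) (σ 0)) (σ 1)), ret (σ 0) (cons (head (σ 2)) (σ 1))),
   (step (ret (contComp (σ 2) (σ 0)) (σ 1)), run (σ 2) (σ 0) (σ 1)),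
   (step (ret (contFix (σ 2) (σ 0)) nil), ret (σ 0) nil),
   (step (ret (contFix (σ 2) (σ 0)) (cons zero (σ 1))), ret (σ 0) (σ 1)),
   (step (ret (contFix (σ 2) (σ 0)) (cons (succ (σ 4)) (σ 1))),
      run (σ 2) (contFix (σ 2) (σ 0)) (σ 1))]

/-- The equations of the machine. -/
def axioms : List (Tm × Tm) := equations .var

/-- Equality in the theory of the machine. -/
abbrev Eqv : Tm → Tm → Prop := EqTheory axioms

/-- Substitution commutes with all the operations, so `equations σ` is the list of axioms with `σ`
applied to both sides. -/
theorem eqv_of_mem {σ : ℕ → Tm} {e : Tm × Tm} (he : e ∈ equations σ) : Eqv e.1 e.2 := by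
  have : equations σ = axioms.map fun e => (e.1.subst σ, e.2.subst σ) := by
    simp only [axioms, equations, List.map, zero, succ, nil, cons, codeZero, codeSucc, codeTail,
      codeCons, codeComp, codeCase, codeFix, contHalt, contCons₁, contCons₂, contComp, contFix,
      halted, ret, run, step, head, tail,
      subst_op₀, subst_op₁, subst_op₂, subst_op₃, Term.subst]
  rw [this, List.mem_map] at he
  obtain ⟨e, he, rfl⟩ := he
  exact .ax e he σ

/-! ### The model of constructor terms -/

/-- Values of the machine: the constructor terms. -/
inductive Val : Type
  | name (n : ℕ)
  | zero
  | succ (x : Val)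
  | nil
  | cons (x v : Val)
  | codeZero
  | codeSucc
  | codeTail
  | codeCons (f g : Val)
  | codeComp (f g : Val)
  | codeCase (f g : Val)
  | codeFix (f : Val)
  | contHalt
  | contCons₁ (f v k : Val)
  | contCons₂ (v k : Val)
  | contComp (f k : Val)
  | contFix (f k : Val)
  | halted
  | ret (k v : Val)
  | run (c k v : Val)

namespace Val

/-- The operations of an algebra are total. The defaults here and in `tail` agree with the equations
for `nil`; on other values they are arbitrary. -/
def head : Val → Val
  | cons x _ => x
  | _ => zero

def tail : Val → Val
  | cons _ v => v
  | _ => nil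

def step : Val → Val
  | run codeZero k v => ret k (cons zero v)
  | run codeSucc k v => ret k (cons (succ v.head) nil)
  | run codeTail k v => ret k v.tail
  | run (codeCons f g) k v => run f (contCons₁ g v k) v
  | run (codeComp f g) k v => run g (contComp f k) v
  | run (codeCase f _) k nil => run f k nil
  | run (codeCase f _) k (cons zero v) => run f k v
  | run (codeCase _ g) k (cons (succ x) v) => run g k (cons x v)
  | run (codeFix f) k v => run f (contFix f k) v
  | ret contHalt _ => halted
  | ret (contCons₁ f u k) v => run f (contCons₂ v k) u
  | ret (contCons₂ u k) v => ret k (cons u.head v)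
  | ret (contComp f k) v => run f k v
  | ret (contFix _ k) nil => ret k nil
  | ret (contFix _ k) (cons zero v) => ret k v
  | ret (contFix f k) (cons (succ _) v) => run f (contFix f k) v
  | x => x

end Val

/-- The operations on values. -/
def valOp (f : Fin 22) : (Fin (machineArity f) → Val) → Val :=
  match f with
    | 0 => fun _ => .zero
    | 1 => fun a : Fin 1 → Val => .succ (a 0)
    | 2 => fun _ => .nil
    | 3 => fun a : Fin 2 → Val => .cons (a 0) (a 1)
    | 4 => fun _ => .codeZero
    | 5 => fun _ => .codeSucc
    | 6 => fun _ => .codeTail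
    | 7 => fun a : Fin 2 → Val => .codeCons (a 0) (a 1)
    | 8 => fun a : Fin 2 → Val => .codeComp (a 0) (a 1)
    | 9 => fun a : Fin 2 → Val => .codeCase (a 0) (a 1)
    | 10 => fun a : Fin 1 → Val => .codeFix (a 0)
    | 11 => fun _ => .contHalt
    | 12 => fun a : Fin 3 → Val => .contCons₁ (a 0) (a 1) (a 2)
    | 13 => fun a : Fin 2 → Val => .contCons₂ (a 0) (a 1)
    | 14 => fun a : Fin 2 → Val => .contComp (a 0) (a 1)
    | 15 => fun a : Fin 2 → Val => .contFix (a 0) (a 1)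
    | 16 => fun _ => .halted
    | 17 => fun a : Fin 2 → Val => .ret (a 0) (a 1)
    | 18 => fun a : Fin 3 → Val => .run (a 0) (a 1) (a 2)
    | 19 => fun a : Fin 1 → Val => (a 0).step
    | 20 => fun a : Fin 1 → Val => (a 0).head
    | 21 => fun a : Fin 1 → Val => (a 0).tail
    | ⟨n + 22, h⟩ => absurd h (by omega)

/-- The algebra of values. -/
def valAlgebra : Algebra machineSig Val := ⟨.name, valOp⟩

/-- The clauses of `Val.head`, `Val.tail` and `Val.step` are the equations read from left to right,
so each one holds by computation. -/
theorem valAlgebra_models : valAlgebra.Models axioms := by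
  intro e he ρ
  simp only [axioms, equations, List.mem_cons, List.not_mem_nil, or_false] at he
  rcases he with rfl | rfl | rfl | rfl | rfl | rfl | rfl | rfl | rfl | rfl | rfl | rfl | rfl |
    rfl | rfl | rfl | rfl | rfl | rfl | rfl <;> rfl

theorem axioms_names : ∀ e ∈ axioms, e.1.names = ∅ ∧ e.2.names = ∅ := by
  intro e he
  simp only [axioms, equations, List.mem_cons, List.not_mem_nil, or_false] at he
  rcases he with rfl | rfl | rfl | rfl | rfl | rfl | rfl | rfl | rfl | rfl | rfl | rfl | rfl |
    rfl | rfl | rfl | rfl | rfl | rfl | rfl <;>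
    simp [zero, succ, nil, cons, codeZero, codeSucc, codeTail, codeCons, codeComp, codeCase,
    codeFix, contHalt, contCons₁, contCons₂, contComp, contFix, halted, ret, run, step, head, tail,
    names_op₀, names_op₁, names_op₂, names_op₃, Term.names]

/-! ### Codes and lists as terms, and the semantics of codes -/

open Function Turing.ToPartrec

section Encoding

def ofNat : ℕ → Tm
  | 0 => zero
  | n + 1 => succ (ofNat n)

def ofList : List ℕ → Tm
  | [] => nil
  | n :: v => cons (ofNat n) (ofList v)

def ofCode : Code → Tm
  | .zero' => codeZero
  | .succ => codeSucc
  | .tail => codeTail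
  | .cons f g => codeCons (ofCode f) (ofCode g)
  | .comp f g => codeComp (ofCode f) (ofCode g)
  | .case f g => codeCase (ofCode f) (ofCode g)
  | .fix f => codeFix (ofCode f)

theorem vars_ofNat (n : ℕ) : (ofNat n).vars = ∅ := by
  induction n with
  | zero => simp only [ofNat, zero, vars_op₀]
  | succ n ih => simp only [ofNat, succ, vars_op₁, ih]

theorem vars_ofList (v : List ℕ) : (ofList v).vars = ∅ := by
  induction v with
  | nil => simp only [ofList, nil, vars_op₀]
  | cons n v ih => simp only [ofList, cons, vars_op₂, vars_ofNat, ih, Finset.union_empty]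

theorem vars_ofCode (c : Code) : (ofCode c).vars = ∅ := by
  induction c <;> simp_all [ofCode, codeZero, codeSucc, codeTail, codeCons, codeComp, codeCase,
    codeFix, vars_op₀, vars_op₁, vars_op₂]

end Encoding

section Semantics

variable {f g : Code} {k : Cont} {u v w : List ℕ}

theorem mem_eval_cons : w ∈ (Code.cons f g).eval v ↔
    ∃ a ∈ f.eval v, ∃ b ∈ g.eval v, w = a.headI :: b := by
  rw [Code.cons_eval]
  refine Part.mem_bind_iff.trans (exists_congr fun a => and_congr_right fun _ =>
    Part.mem_bind_iff.trans (exists_congr fun b => and_congr_right fun _ => Part.mem_some_iff))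

theorem mem_eval_comp : w ∈ (Code.comp f g).eval v ↔ ∃ a ∈ g.eval v, w ∈ f.eval a := by
  rw [Code.comp_eval]
  exact Part.mem_bind_iff

theorem mem_eval_fix : w ∈ (Code.fix f).eval v ↔
    ∃ a ∈ f.eval v, if a.headI = 0 then w = a.tail else w ∈ (Code.fix f).eval a.tail := by
  rw [Code.fix_eval]
  refine PFun.mem_fix_iff.trans ⟨?_, ?_⟩
  · rintro (h | ⟨b, h, hb⟩) <;> obtain ⟨a, ha, e⟩ := (Part.mem_map_iff _).1 h <;>
      refine ⟨a, ha, ?_⟩ <;> split_ifs at e ⊢ <;> cases e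
    exacts [rfl, hb]
  · rintro ⟨a, ha, h⟩
    split_ifs at h with h0
    · exact .inl ((Part.mem_map_iff _).2 ⟨a, ha, by simp [h0, h]⟩)
    · exact .inr ⟨_, (Part.mem_map_iff _).2 ⟨a, ha, if_neg h0⟩, h⟩

theorem mem_contEval_cons₁ : w ∈ (Cont.cons₁ g u k).eval v ↔
    ∃ b ∈ g.eval u, w ∈ k.eval (v.headI :: b) :=
  Part.mem_bind_iff

theorem mem_contEval_comp : w ∈ (Cont.comp f k).eval v ↔ ∃ a ∈ f.eval v, w ∈ k.eval a :=
  Part.mem_bind_iff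

theorem mem_contEval_fix : w ∈ (Cont.fix f k).eval v ↔
    if v.headI = 0 then w ∈ k.eval v.tail else ∃ a ∈ f.fix.eval v.tail, w ∈ k.eval a := by
  change w ∈ (if v.headI = 0 then k.eval v.tail else f.fix.eval v.tail >>= k.eval) ↔ _
  split_ifs
  exacts [.rfl, Part.mem_bind_iff]

end Semantics

/-! ### A terminating evaluation drives the machine to `halted` -/

section Steps

/-- The configuration `M` evolves to `N` by finitely many applications of `step`. -/
def Steps (M N : Tm) : Prop := ∃ n, Eqv (step^[n] M) N

variable {M N K : Tm}

theorem Steps.of_step (h : Eqv (step M) N) : Steps M N := ⟨1, h⟩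

/-- Equality in the theory is a congruence, so it survives further applications of `step`. -/
theorem Steps.trans (h₁ : Steps M N) (h₂ : Steps N K) : Steps M K := by
  obtain ⟨m, h₁⟩ := h₁
  obtain ⟨n, h₂⟩ := h₂
  have h : ∀ n, Eqv (step^[n] (step^[m] M)) (step^[n] N) := by
    intro n
    induction n with
    | zero => exact h₁
    | succ n ih =>
      rw [iterate_succ_apply', iterate_succ_apply']
      exact congr_op₁ _ ih
  exact ⟨n + m, by rw [iterate_add_apply]; exact (h n).trans h₂⟩

theorem head_ofList (v : List ℕ) : Eqv (head (ofList v)) (ofNat v.headI) := by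
  cases v with
  | nil => exact eqv_of_mem (σ := .var) (e := (_, _)) (.head _)
  | cons n v =>
    exact eqv_of_mem (σ := fun i => i.casesOn (ofNat n) fun _ => ofList v) (e := (_, _))
      (List.mem_cons_of_mem _ (.head _))

theorem tail_ofList (v : List ℕ) : Eqv (tail (ofList v)) (ofList v.tail) := by
  cases v with
  | nil => exact eqv_of_mem (σ := .var) (e := (_, _)) (.tail _ (.tail _ (.head _)))
  | cons n v =>
    exact eqv_of_mem (σ := fun i => i.casesOn (ofNat n) fun _ => ofList v) (e := (_, _))
      (.tail _ (.tail _ (.tail _ (.head _))))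

/-- The valuation with the given values on the first five variables. -/
def val (x₀ x₁ x₂ x₃ x₄ : Tm) : ℕ → Tm
  | 0 => x₀
  | 1 => x₁
  | 2 => x₂
  | 3 => x₃
  | _ => x₄

/-- The arguments instantiate the variables 0 to 4 of `equations`, usually continuation, list, two
codes and a predecessor, so that each use leaves a membership that `simp` decides. -/
theorem step_eqv_of_mem {x y : Tm} (k v f g n : Tm)
    (h : (x, y) ∈ equations (val k v f g n)) : Eqv x y :=
  eqv_of_mem h

theorem steps_contFix (f k : Tm) (v : List ℕ) :
    Steps (ret (contFix f k) (ofList v))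
      (if v.headI = 0 then ret k (ofList v.tail) else run f (contFix f k) (ofList v.tail)) := by
  refine .of_step ?_
  match v with
  | [] => exact step_eqv_of_mem k nil f nil nil (by simp [equations, val, ofList])
  | 0 :: v => exact step_eqv_of_mem k (ofList v) f nil nil (by simp [equations, val, ofList, ofNat])
  | (n + 1) :: v =>
    exact step_eqv_of_mem k (ofList v) f nil (ofNat n) (by simp [equations, val, ofList, ofNat])

/-- Induction on the code. The continuation is an arbitrary term, because the subcodes run under
extended continuations. -/
theorem steps_run (c : Code) {v w : List ℕ} (h : w ∈ c.eval v) (k : Tm) :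
    Steps (run (ofCode c) k (ofList v)) (ret k (ofList w)) := by
  induction c generalizing v w k with
  | zero' =>
    simp only [Code.zero'_eval, Part.pure_eq_some, Part.mem_some_iff] at h
    subst h
    exact .of_step (step_eqv_of_mem k (ofList v) nil nil nil
      (by simp [equations, val, ofList, ofNat, ofCode]))
  | succ =>
    simp only [Code.succ_eval, Part.pure_eq_some, Part.mem_some_iff] at h
    subst h
    exact .of_step ((step_eqv_of_mem (y := ret k (cons (succ (head (ofList v))) nil))
      k (ofList v) nil nil nil (by simp [equations, val, ofCode])).trans
      (congr_op₂ _ (.refl _) (congr_op₂ _ (congr_op₁ _ (head_ofList v)) (.refl _))))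
  | tail =>
    simp only [Code.tail_eval, Part.pure_eq_some, Part.mem_some_iff] at h
    subst h
    exact .of_step ((step_eqv_of_mem (y := ret k (tail (ofList v)))
      k (ofList v) nil nil nil (by simp [equations, val, ofCode])).trans
      (congr_op₂ _ (.refl _) (tail_ofList v)))
  | cons f g ihf ihg =>
    obtain ⟨a, ha, b, hb, rfl⟩ := mem_eval_cons.1 h
    refine .trans (.of_step (step_eqv_of_mem (y := run (ofCode f)
      (contCons₁ (ofCode g) (ofList v) k) (ofList v)) k (ofList v) (ofCode f) (ofCode g) nil
      (by simp [equations, val, ofCode]))) (.trans (ihf ha _) ?_)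
    refine .trans (.of_step (step_eqv_of_mem (y := run (ofCode g)
      (contCons₂ (ofList a) k) (ofList v)) k (ofList a) (ofCode g) (ofList v) nil
      (by simp [equations, val]))) (.trans (ihg hb _) ?_)
    exact .of_step ((step_eqv_of_mem (y := ret k (cons (head (ofList a)) (ofList b)))
      k (ofList b) (ofList a) nil nil (by simp [equations, val])).trans
      (congr_op₂ _ (.refl _) (congr_op₂ _ (head_ofList a) (.refl _))))
  | comp f g ihf ihg =>
    obtain ⟨a, ha, hb⟩ := mem_eval_comp.1 h
    refine .trans (.of_step (step_eqv_of_mem (y := run (ofCode g)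
      (contComp (ofCode f) k) (ofList v)) k (ofList v) (ofCode f) (ofCode g) nil
      (by simp [equations, val, ofCode]))) (.trans (ihg ha _) ?_)
    exact .trans (.of_step (step_eqv_of_mem (y := run (ofCode f) k (ofList a))
      k (ofList a) (ofCode f) nil nil (by simp [equations, val]))) (ihf hb _)
  | case f g ihf ihg =>
    rw [Code.case_eval] at h
    match v with
    | [] =>
      exact .trans (.of_step (step_eqv_of_mem (y := run (ofCode f) k nil)
        k nil (ofCode f) (ofCode g) nil (by simp [equations, val, ofCode, ofList]))) (ihf h k)
    | 0 :: v =>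
      exact .trans (.of_step (step_eqv_of_mem (y := run (ofCode f) k (ofList v))
        k (ofList v) (ofCode f) (ofCode g) nil
        (by simp [equations, val, ofCode, ofList, ofNat]))) (ihf h k)
    | (n + 1) :: v =>
      exact .trans (.of_step (step_eqv_of_mem (y := run (ofCode g) k (ofList (n :: v)))
        k (ofList v) (ofCode f) (ofCode g) (ofNat n)
        (by simp [equations, val, ofCode, ofList, ofNat]))) (ihg h k)
  | fix f ih =>
    rw [Code.fix_eval] at h
    refine .trans (.of_step (step_eqv_of_mem (y := run (ofCode f)
      (contFix (ofCode f) k) (ofList v)) k (ofList v) (ofCode f) nil nil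
      (by simp [equations, val, ofCode]))) ?_
    -- A second induction, on the rounds of the loop. Its motive starts after the loop has been
    -- entered, since `contFix` restarts the body itself rather than the code `codeFix`.
    refine PFun.fixInduction' (C := fun v =>
      Steps (run (ofCode f) (contFix (ofCode f) k) (ofList v)) (ret k (ofList w))) h
      (fun v hv => ?_) (fun v u _ hu hs => ?_)
    · obtain ⟨a, ha, e⟩ := (Part.mem_map_iff _).1 hv
      split_ifs at e with h0
      cases e
      have := steps_contFix (ofCode f) k a
      rw [if_pos h0] at this
      exact (ih ha _).trans this
    · obtain ⟨a, ha, e⟩ := (Part.mem_map_iff _).1 hu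
      split_ifs at e with h0
      cases e
      have := steps_contFix (ofCode f) k a
      rw [if_neg h0] at this
      exact ((ih ha _).trans this).trans hs

theorem steps_halted (c : Code) {v : List ℕ} (h : (c.eval v).Dom) :
    Steps (run (ofCode c) contHalt (ofList v)) halted :=
  (steps_run c (Part.get_mem h) contHalt).trans (.of_step (step_eqv_of_mem nil
    (ofList ((c.eval v).get h)) nil nil nil (by simp [equations, val])))

end Steps

/-! ### In the model, reaching `halted` implies that the evaluation terminates -/

namespace Val

def ofNat : ℕ → Val
  | 0 => zero
  | n + 1 => succ (ofNat n)

def ofList : List ℕ → Val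
  | [] => nil
  | n :: v => cons (ofNat n) (ofList v)

def ofCode : Code → Val
  | .zero' => codeZero
  | .succ => codeSucc
  | .tail => codeTail
  | .cons f g => codeCons (ofCode f) (ofCode g)
  | .comp f g => codeComp (ofCode f) (ofCode g)
  | .case f g => codeCase (ofCode f) (ofCode g)
  | .fix f => codeFix (ofCode f)

def ofCont : Cont → Val
  | .halt => contHalt
  | .cons₁ f v k => contCons₁ (ofCode f) (ofList v) (ofCont k)
  | .cons₂ v k => contCons₂ (ofList v) (ofCont k)
  | .comp f k => contComp (ofCode f) (ofCont k)
  | .fix f k => contFix (ofCode f) (ofCont k)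

theorem head_ofList (v : List ℕ) : (ofList v).head = ofNat v.headI := by
  cases v <;> rfl

theorem tail_ofList (v : List ℕ) : (ofList v).tail = ofList v.tail := by
  cases v <;> rfl

/-- A continuation after the code of a loop behaves like the loop that follows. -/
theorem exists_mem_eval_fix {f : Code} {k : Cont} {u v w : List ℕ} (hw : w ∈ f.eval v)
    (hu : u ∈ (Cont.fix f k).eval w) : ∃ a ∈ f.fix.eval v, u ∈ k.eval a := by
  rw [mem_contEval_fix] at hu
  split_ifs at hu with h0
  · exact ⟨_, mem_eval_fix.2 ⟨w, hw, by rw [if_pos h0]⟩, hu⟩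
  · obtain ⟨a, ha, hu⟩ := hu
    exact ⟨a, mem_eval_fix.2 ⟨w, hw, by rwa [if_neg h0]⟩, hu⟩

/-- Induction on the number of steps, for both kinds of configuration at once: one step turns an
encoded configuration into another whose denotation is defined only if that of the first is. The
result `u` is existential because `halted` forgets it. -/
theorem exists_mem_eval_of_iterate_step (n : ℕ) :
    (∀ (c : Code) (k : Cont) (v : List ℕ),
      step^[n] (run (ofCode c) (ofCont k) (ofList v)) = halted →
        ∃ u, ∃ w ∈ c.eval v, u ∈ k.eval w) ∧
    ∀ (k : Cont) (v : List ℕ), step^[n] (ret (ofCont k) (ofList v)) = halted →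
      ∃ u, u ∈ k.eval v := by
  induction n with
  -- With no step taken, `run` and `ret` are constructors different from `halted`.
  | zero => exact ⟨fun _ _ _ h => (by cases h), fun _ _ h => (by cases h)⟩
  | succ n ih =>
    obtain ⟨ih₁, ih₂⟩ := ih
    refine ⟨fun c k v h => ?_, fun k v h => ?_⟩
    · rw [iterate_succ_apply] at h
      cases c with
      | zero' => exact (ih₂ k (0 :: v) h).imp fun u hu => ⟨_, by simp, hu⟩
      | succ =>
        simp only [ofCode, step, head_ofList] at h
        exact (ih₂ k [v.headI.succ] h).imp fun u hu => ⟨_, by simp, hu⟩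
      | tail =>
        simp only [ofCode, step, tail_ofList] at h
        exact (ih₂ k v.tail h).imp fun u hu => ⟨_, by simp, hu⟩
      | cons f g =>
        obtain ⟨u, a, ha, hu⟩ := ih₁ f (.cons₁ g v k) v h
        obtain ⟨b, hb, hu⟩ := mem_contEval_cons₁.1 hu
        exact ⟨u, _, mem_eval_cons.2 ⟨a, ha, b, hb, rfl⟩, hu⟩
      | comp f g =>
        obtain ⟨u, a, ha, hu⟩ := ih₁ g (.comp f k) v h
        obtain ⟨b, hb, hu⟩ := mem_contEval_comp.1 hu
        exact ⟨u, b, mem_eval_comp.2 ⟨a, ha, hb⟩, hu⟩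
      | case f g =>
        rw [Code.case_eval]
        match v with
        | [] => exact ih₁ f k [] h
        | 0 :: v => exact ih₁ f k v h
        | (m + 1) :: v => exact ih₁ g k (m :: v) h
      | fix f =>
        obtain ⟨u, w, hw, hu⟩ := ih₁ f (.fix f k) v h
        exact ⟨u, exists_mem_eval_fix hw hu⟩
    · rw [iterate_succ_apply] at h
      cases k with
      | halt => exact ⟨v, Part.mem_some v⟩
      | cons₁ f w k =>
        obtain ⟨u, b, hb, hu⟩ := ih₁ f (.cons₂ v k) w h
        exact ⟨u, mem_contEval_cons₁.2 ⟨b, hb, hu⟩⟩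
      | cons₂ w k =>
        simp only [ofCont, step, head_ofList] at h
        exact ih₂ k (w.headI :: v) h
      | comp f k => exact (ih₁ f k v h).imp fun u hu => mem_contEval_comp.2 hu
      | fix f k =>
        match v with
        | [] => exact (ih₂ k [] h).imp fun u hu => mem_contEval_fix.2 hu
        | 0 :: v => exact (ih₂ k v h).imp fun u hu => mem_contEval_fix.2 hu
        | (m + 1) :: v =>
          obtain ⟨u, w, hw, hu⟩ := ih₁ f (.fix f k) v h
          exact ⟨u, mem_contEval_fix.2 (exists_mem_eval_fix hw hu)⟩

end Val

theorem eval_ofNat (ρ : ℕ → Val) (n : ℕ) : (ofNat n).eval valAlgebra ρ = .ofNat n := by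
  induction n with
  | zero => rfl
  | succ n ih => exact congrArg Val.succ ih

theorem eval_ofList (ρ : ℕ → Val) (v : List ℕ) : (ofList v).eval valAlgebra ρ = .ofList v := by
  induction v with
  | nil => rfl
  | cons n v ih => exact congrArg₂ Val.cons (eval_ofNat ρ n) ih

theorem eval_ofCode (ρ : ℕ → Val) (c : Code) : (ofCode c).eval valAlgebra ρ = .ofCode c := by
  induction c with
  | zero' | succ | tail => rfl
  | cons f g ihf ihg => exact congrArg₂ Val.codeCons ihf ihg
  | comp f g ihf ihg => exact congrArg₂ Val.codeComp ihf ihg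
  | case f g ihf ihg => exact congrArg₂ Val.codeCase ihf ihg
  | fix f ih => exact congrArg Val.codeFix ih

/-! ### The reduction from the halting problem -/

/-- The process that evaluates the code `c` on the input `n`. -/
def evalProc (c : Code) (n : ℕ) : Proc machineSig :=
  loopFrom (step (.var 0)) halted (run (ofCode c) contHalt (ofList [n]))

/-- The process that has arrived at the end of an evaluation. -/
def haltedProc : Proc machineSig := loopFrom (step (.var 0)) halted halted

/-- The trace of `haltedProc` that signals the end of the evaluation. -/
def haltedTrace : List (Action machineSig × Proc machineSig) :=
  [(.out 1 (.name 1), loopEnd (step (.var 0)) halted)]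

theorem vars_step : (step (.var 0)).vars ⊆ {0} := by
  simp only [step, vars_op₁, Term.vars, Finset.Subset.refl]

theorem vars_halted : halted.vars = ∅ := by
  simp only [halted, vars_op₀]

theorem vars_run (c : Code) (n : ℕ) : (run (ofCode c) contHalt (ofList [n])).vars = ∅ := by
  simp only [run, contHalt, vars_op₀, vars_op₃, vars_ofCode, vars_ofList, Finset.union_empty]

theorem evalProc_match_iff (c : Code) (n : ℕ) :
    (∃ t, SafeTrace Eqv (evalProc c n) t ∧
      TraceEquiv Eqv haltedProc haltedTrace (evalProc c n) t) ↔ (c.eval [n]).Dom := by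
  refine ⟨fun h => ?_, fun h => ?_⟩
  -- The start configuration and `halted` are ground, so any valuation will do.
  · obtain ⟨m, hm⟩ := exists_iterate_eq_of_loopFrom_match valAlgebra_models
      (by simp [valAlgebra]) vars_halted (fun _ => .zero) h
    have e : (run (ofCode c) contHalt (ofList [n])).eval valAlgebra (fun _ => .zero) =
        .run (.ofCode c) (.ofCont .halt) (.ofList [n]) :=
      congrArg₂ (Val.run · .contHalt ·) (eval_ofCode _ c) (eval_ofList _ [n])
    rw [e] at hm
    obtain ⟨-, w, hw, -⟩ := (Val.exists_mem_eval_of_iterate_step m).1 c .halt [n] hm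
    exact Part.dom_iff_mem.2 ⟨w, hw⟩
  · obtain ⟨m, hm⟩ := steps_halted c h
    refine loopFrom_match vars_step vars_halted (n := m) (vars_run c n) ?_
    have e : (fun N => Term.subst (single 0 N) (step (.var 0))) = step := by
      funext N
      simp only [step, subst_op₁, Term.subst, single, if_true]
    rwa [e]

theorem haltedProc_safeTrace : SafeTrace Eqv haltedProc haltedTrace :=
  loopFrom_safeTrace vars_step vars_halted (n := 0) vars_halted (.refl _)

theorem computable_code_ofNat : Computable fun n => (ofNat n).code := by
  refine Primrec.to_comp ((Primrec.nat_rec₁ zero.code (f := fun _ m =>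
    Nat.pair 2 (Nat.pair 1 (Encodable.encode [m]))) ?_).of_eq fun n => ?_)
  · exact Primrec₂.natPair.comp (.const _) (Primrec₂.natPair.comp (.const _)
      (Primrec.encode.comp (Primrec.list_cons.comp Primrec.snd (.const []))))
  · induction n with
    | zero => rfl
    | succ n ih =>
      simp only [ofNat, succ, code_op₁, ← ih]
      rfl

/-- Only the numeral for `n` varies; everything around it in the code of the instance is constant.
-/
theorem computable_instCode (c : Code) :
    Computable fun n => instCode (evalProc c n) haltedProc haltedTrace := by
  have pair : ∀ {f g : ℕ → ℕ}, Computable f → Computable g →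
      Computable fun n => Nat.pair (f n) (g n) :=
    fun hf hg => Primrec₂.natPair.to_comp.comp hf hg
  have cons : ∀ {f : ℕ → ℕ} {g : ℕ → List ℕ}, Computable f → Computable g →
      Computable fun n => f n :: g n :=
    fun hf hg => Computable.list_cons.comp hf hg
  have k : ∀ {α : Type} [Primcodable α] (a : α), Computable fun _ : ℕ => a := fun a => .const a
  simp only [instCode, evalProc, loopFrom, Proc.code, run, ofList, AppliedPi.Machine.cons,
    code_op₂, code_op₃]
  refine pair (pair (k _) (pair (k _) (pair (k _) (pair ?_ (k _))))) (k _)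
  refine pair (k _) (pair (k _) (pair ?_ (k _)))
  refine pair (k _) (pair (k _) (Computable.encode.comp (cons (k _) (cons (k _) (cons ?_ (k _))))))
  exact pair (k _) (pair (k _)
    (Computable.encode.comp (cons computable_code_ofNat (cons (k _) (k _)))))

/-- Take a code for the universal function that runs the `n`-th partial recursive program on input
0; deciding its domain would solve the halting problem. -/
theorem exists_code_undecidable :
    ∃ c : Code, ¬ ComputablePred fun n => (c.eval [n]).Dom := by
  let f : ℕ →. ℕ := fun n => (Denumerable.ofNat Nat.Partrec.Code n).eval 0
  have hf : Partrec f :=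
    Nat.Partrec.Code.eval_part.comp (Computable.ofNat _) (Computable.const 0)
  obtain ⟨c, hc⟩ := Code.exists_code (Nat.Partrec'.part_iff₁.2 hf)
  refine ⟨c, fun h => ComputablePred.halting_problem 0 ?_⟩
  obtain ⟨g, hg, e⟩ := ComputablePred.computable_iff.1 h
  refine ComputablePred.computable_iff.2 ⟨_, hg.comp Computable.encode, funext fun d => ?_⟩
  rw [← congrFun e (Encodable.encode d)]
  have := hc (Encodable.encode d ::ᵥ .nil)
  simp only [List.Vector.head_cons, f, Denumerable.ofNat_encode] at this
  change _ = (c.eval (Encodable.encode d ::ᵥ List.Vector.nil).1).Dom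
  rw [this]
  rfl

/-- All instances of the reduction are valid and plain, so one argument covers every class that
contains the plain processes. -/
theorem not_traceProblemDecidable {C : Proc machineSig → Prop} (hC : ∀ A, A.Plain → C A) :
    ¬ TraceProblemDecidable Eqv C := by
  classical
  rintro ⟨f, hf, h⟩
  obtain ⟨c, hc⟩ := exists_code_undecidable
  refine hc ?_
  have key := fun n => h (evalProc c n) haltedProc haltedTrace (loopFrom_plain _ _ _).wf
    (loopFrom_plain _ _ _).wf (loopFrom_closed vars_step vars_halted (vars_run c n))
    (loopFrom_closed vars_step vars_halted vars_halted) (hC _ (loopFrom_plain _ _ _))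
    (hC _ (loopFrom_plain _ _ _)) haltedProc_safeTrace
  simp only [evalProc_match_iff] at key
  -- The algorithm may diverge on data that code no instance, but composed with the computable
  -- instance map it is total.
  have hg : Computable fun n => if (c.eval [n]).Dom then 1 else 0 := by
    refine ((Partrec.nat_iff.2 hf).comp (computable_instCode c)).of_eq_tot fun n => ?_
    split_ifs with hn
    exacts [(key n).1 hn, (key n).2 hn]
  refine ComputablePred.computable_iff.2
    ⟨fun n => decide ((if (c.eval [n]).Dom then 1 else 0) = 1), ?_, ?_⟩
  · exact (Primrec.eq (α := ℕ)).decide.to_comp.comp hg (.const 1)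
  · funext n
    by_cases hn : (c.eval [n]).Dom <;> simp [hn]

end Machine

end AppliedPi

theorem mainTheorem7 :
    ∃ (S : AppliedPi.Signature) (ax : List (AppliedPi.Term S × AppliedPi.Term S)),
      (∀ e ∈ ax, e.1.names = ∅ ∧ e.2.names = ∅) ∧
      ¬ AppliedPi.TraceProblemDecidable (AppliedPi.EqTheory ax) (fun _ => True) ∧
      ¬ AppliedPi.TraceProblemDecidable (AppliedPi.EqTheory ax) AppliedPi.Proc.Plain :=
  ⟨AppliedPi.machineSig, AppliedPi.Machine.axioms, AppliedPi.Machine.axioms_names,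
    AppliedPi.Machine.not_traceProblemDecidable fun _ _ => trivial,
    AppliedPi.Machine.not_traceProblemDecidable fun _ h => h⟩
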